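/- Let $(\Omega,\mathcal F,\mathbb P)$ be a probability space. For a two-parameter function $Y$ write $\Delta_{s,t}Y(s',t'):=Y(s',t')-Y(s,t')-Y(s',t)+Y(s,t)$, and for a rectangle $Q=(s,s']\times(t,t']\subset\mathbb R_+^2$ put $\Delta_QY:=\Delta_{s,t}Y(s',t')$. Let $L=\{L(x,y);\,x,y\ge 0\}$ be a (jointly measurable) real-valued Lévy sheet with exponent $\Psi:\mathbb R\to\mathbb C$, that is: $L$ is continuous in probability; $L(x,0)=L(0,y)=0$ almost surely for all $x,y\ge0$; the increments $\Delta_{Q_1}L,\dots,\Delta_{Q_n}L$ are independent for any pairwise disjoint rectangles $Q_1,\dots,Q_n$; and $\mathbb E[e^{i\xi\Delta_QL}]=e^{-\lambda(Q)\Psi(\xi)}$ for every rectangle $Q$ and every $\xi\in\mathbb R$, where $\lambda$ is Lebesgue measure. Write $\Psi=a+ib$ with $a,b$ real-valued. Let $\theta\in(0,2\pi)$ with $a(\theta)\neq0$, let $S,T>0$, and for $\varepsilon>0$ and $(s,t)\in[0,S]\times[0,T]$ set $$X_\varepsilon(s,t):=\varepsilon K\int_0^{t/\varepsilon}\int_0^{s/\varepsilon}\sqrt{xy}\,\{\cos(\theta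 L(x,y))+i\sin(\theta L(x,y))\}\,dx\,dy,\qquad K:=\frac1{\sqrt2}\,\frac{a(\theta)^2+b(\theta)^2}{a(\theta)}.$$ Then there exists a constant $C>0$ such that, for all $0\le s<s'\le S$ and $0\le t<t'\le T$, $$\sup_{\varepsilon>0}\mathbb E\left[\left|\Delta_{s,t}X_\varepsilon(s',t')\right|^4\right]\le C(s'-s)^2(t'-t)^2.$$ Moreover, each $X_\varepsilon$ is a random element of $\mathcal C([0,S]\times[0,T];\mathbb C)$ (with the uniform topology and its Borel $\sigma$-algebra), and the family of probability laws of $(X_\varepsilon)_{\varepsilon>0}$ is tight in $\mathcal C([0,S]\times[0,T];\mathbb C)$. -/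

import Mathlib

open MeasureTheory ProbabilityTheory
open scoped NNReal ENNReal Topology

namespace LevySheet

/-- The increment `Δ_{s,t} Y(s',t') = Y(s',t') - Y(s,t') - Y(s',t) + Y(s,t)` of a two-parameter
function `Y` on the rectangle with lower-left corner `(s,t)` and upper-right corner `(s',t')`. -/
def increment {α E : Type*} [AddCommGroup E] (Y : α → α → E) (s t s' t' : α) : E :=
  Y s' t' - Y s t' - Y s' t + Y s t

/-- A (nondegenerate) half-open rectangle `(x₁, x₂] × (y₁, y₂]` in the quadrant `ℝ₊²`. -/
structure Rectangle where
  (x₁ x₂ y₁ y₂ : ℝ≥0)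
  hx : x₁ < x₂
  hy : y₁ < y₂

/-- The set of points of a rectangle. -/
def Rectangle.toSet (Q : Rectangle) : Set (ℝ≥0 × ℝ≥0) :=
  Set.Ioc Q.x₁ Q.x₂ ×ˢ Set.Ioc Q.y₁ Q.y₂

/-- The Lebesgue measure of a rectangle. -/
def Rectangle.area (Q : Rectangle) : ℝ :=
  ((Q.x₂ : ℝ) - Q.x₁) * ((Q.y₂ : ℝ) - Q.y₁)

/-- The increment `Δ_Q L` of a real random field on the rectangle `Q`. -/
def Rectangle.incr {Ω : Type*} (Q : Rectangle) (L : ℝ≥0 → ℝ≥0 → Ω → ℝ) (ω : Ω) : ℝ :=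
  increment (fun x y => L x y ω) Q.x₁ Q.y₁ Q.x₂ Q.y₂

/-- `L` is a Lévy sheet with exponent `Ψ` under `P`: a real random field on `ℝ₊²`, null on the axes,
continuous in probability, with independent increments on disjoint rectangles, and such that
`E[exp(i ξ Δ_Q L)] = exp(-λ(Q) Ψ(ξ))` for every rectangle `Q` and every real `ξ`. -/
structure IsLevySheet {Ω : Type*} [MeasurableSpace Ω] (L : ℝ≥0 → ℝ≥0 → Ω → ℝ) (Ψ : ℝ → ℂ)
    (P : Measure Ω) : Prop where
  measurable : ∀ x y, Measurable (L x y)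
  axis_left : ∀ y, ∀ᵐ ω ∂P, L 0 y ω = 0
  axis_right : ∀ x, ∀ᵐ ω ∂P, L x 0 ω = 0
  continuous_in_probability : ∀ z : ℝ≥0 × ℝ≥0,
    TendstoInMeasure P (fun w : ℝ≥0 × ℝ≥0 => L w.1 w.2) (𝓝 z) (L z.1 z.2)
  indep_increments : ∀ (n : ℕ) (Q : Fin n → Rectangle),
    Pairwise (fun i j => Disjoint (Q i).toSet (Q j).toSet) →
      iIndepFun (fun i => (Q i).incr L) P
  charFun_increment : ∀ (Q : Rectangle) (ξ : ℝ),
    ∫ ω, Complex.exp (Complex.I * ξ * (Q.incr L ω : ℝ)) ∂P =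
      Complex.exp (-(Q.area : ℂ) * Ψ ξ)

/-- The constant `K = (1/√2) (a(θ)² + b(θ)²) / a(θ)`, where `a = Re Ψ` and `b = Im Ψ`. -/
noncomputable def normConst (Ψ : ℝ → ℂ) (θ : ℝ) : ℝ :=
  1 / √2 * (((Ψ θ).re ^ 2 + (Ψ θ).im ^ 2) / (Ψ θ).re)

/-- The random field
`X_ε(s,t) = ε K ∫_0^{t/ε} ∫_0^{s/ε} √(xy) (cos(θ L(x,y)) + i sin(θ L(x,y))) dx dy`. -/
noncomputable def approxField {Ω : Type*} (L : ℝ≥0 → ℝ≥0 → Ω → ℝ) (Ψ : ℝ → ℂ)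
    (θ ε s t : ℝ) (ω : Ω) : ℂ :=
  (ε : ℂ) * (normConst Ψ θ : ℂ) *
    ∫ y in (0 : ℝ)..(t / ε), ∫ x in (0 : ℝ)..(s / ε),
      (√(x * y) : ℂ) *
        ((Real.cos (θ * L x.toNNReal y.toNNReal ω) : ℂ) +
          Complex.I * (Real.sin (θ * L x.toNNReal y.toNNReal ω) : ℂ))

/-- The space `C([0,S] × [0,T]; ℂ)` with the topology of uniform convergence. -/
abbrev PathSpace (S T : ℝ) : Type :=
  C(Set.Icc (0 : ℝ) S × Set.Icc (0 : ℝ) T, ℂ)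

/-- The path space carries its Borel `σ`-algebra. -/
noncomputable instance instMeasurableSpacePathSpace (S T : ℝ) : MeasurableSpace (PathSpace S T) :=
  borel _

instance instBorelSpacePathSpace (S T : ℝ) : BorelSpace (PathSpace S T) :=
  ⟨rfl⟩

end LevySheet

/-!
Fourth moments and tightness of the fields `X_ε` built from a Lévy sheet `L`.

**Fourth moments.** Up to the factor `ε K` an increment of `X_ε` is an integral `Z = ∫∫ √(xy)
e^{iθL(x,y)} dx dy` over a box, and `E|Z|⁴` is a weighted integral over four points `p₁, …, p₄` of
the box of `E exp (iθ (L(p₁) - L(p₂) + L(p₃) - L(p₄)))`. The coordinates of the points cut the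
quadrant into a grid whose cells carry independent increments; the increment over a cell enters
with the coefficient `θ` times the signed number of points that dominate the cell. Every cell
contributes a factor of modulus at most one, since `Re Ψ ≥ 0`, and the factor `exp (-area * Re
Ψ(θ))` where the coefficient is `±θ`. In the lowest row and in the first column there are four
cells of this kind, and they give
`|E …| ≤ exp (-Re Ψ(θ) (x₁ ((y₂ - y₁) + (y₄ - y₃)) + y₁ ((x₂ - x₁) + (x₄ - x₃))))`
with both sets of coordinates in increasing order (`norm_integral_exp_four_points`). No other
multiple of `θ` is needed, which matters because `Re Ψ(2θ)` may vanish. If the box is no longer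
and no higher than its distances to the axes, then the weights `√(xy)` are comparable to
constants, the bound factorizes, and integration gives `E|Z|⁴ ≤ C area²`
(`IsLevySheet.integral_norm_boxIntegral_pow_four_le`). An arbitrary box is halved repeatedly
towards the axes; by the triangle inequality in `L⁴` the contributions form a geometric series
(`le_sqrt_of_halving`, `IsLevySheet.lpNorm_boxIntegral_le`). The powers of `ε` cancel.

**Tightness.** The expected value of the sum of `ρ^{-4(j+k)} |Δ|⁴` over all dyadic cells of size
`2⁻ʲ × 2⁻ᵏ` is finite, uniformly in `ε`, for a suitable `ρ < 1`. A one-parameter chaining argument,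
applied in each variable in turn, converts a bound on this sum into a modulus of continuity
(`norm_increment_le_of_dyadic`); the Arzelà–Ascoli theorem and Markov's inequality conclude
(`isTightMeasureSet_of_increment_moment`).
-/

/-! ### Characteristic functions of linear combinations of sheet values -/

namespace LevySheet

lemma sum_increment_grid (Y : ℝ≥0 → ℝ≥0 → ℝ) (U V : ℕ → ℝ≥0) (m n : ℕ) :
    ∑ i ∈ Finset.range m, ∑ j ∈ Finset.range n,
      increment Y (U i) (V j) (U (i + 1)) (V (j + 1)) = increment Y (U 0) (V 0) (U m) (V n) := by
  have h1 : ∀ i, ∑ j ∈ Finset.range n, increment Y (U i) (V j) (U (i + 1)) (V (j + 1)) =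
      (Y (U (i + 1)) (V n) - Y (U (i + 1)) (V 0)) - (Y (U i) (V n) - Y (U i) (V 0)) := by
    intro i
    rw [← Finset.sum_range_sub (fun j => Y (U (i + 1)) (V j)),
      ← Finset.sum_range_sub (fun j => Y (U i) (V j)), ← Finset.sum_sub_distrib]
    exact Finset.sum_congr rfl fun j _ => by simp only [increment]; ring
  simp_rw [h1]
  rw [Finset.sum_range_sub (fun i => Y (U i) (V n) - Y (U i) (V 0))]
  simp only [increment]; ring

namespace IsLevySheet

variable {Ω : Type*} [MeasurableSpace Ω] {P : Measure Ω} {L : ℝ≥0 → ℝ≥0 → Ω → ℝ} {Ψ : ℝ → ℂ}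

lemma measurable_increment (hL : IsLevySheet L Ψ P) (a b a' b' : ℝ≥0) :
    Measurable fun ω => increment (fun x y => L x y ω) a b a' b' :=
  (((hL.measurable a' b').sub (hL.measurable a b')).sub (hL.measurable a' b)).add
    (hL.measurable a b)

lemma norm_integral_exp_rectangle (hL : IsLevySheet L Ψ P) (Q : Rectangle) (ξ : ℝ) :
    ‖∫ ω, Complex.exp (Complex.I * ξ * (Q.incr L ω : ℝ)) ∂P‖ =
      Real.exp (-(Q.area * (Ψ ξ).re)) := by
  rw [hL.charFun_increment, Complex.norm_exp]
  simp [Complex.mul_re]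

lemma re_exponent_nonneg [IsProbabilityMeasure P] (hL : IsLevySheet L Ψ P) (ξ : ℝ) :
    0 ≤ (Ψ ξ).re := by
  have h := hL.norm_integral_exp_rectangle ⟨0, 1, 0, 1, zero_lt_one, zero_lt_one⟩ ξ
  have h1 : ‖∫ ω, Complex.exp (Complex.I * ξ *
      ((⟨0, 1, 0, 1, zero_lt_one, zero_lt_one⟩ : Rectangle).incr L ω : ℝ)) ∂P‖ ≤ 1 := by
    refine (norm_integral_le_of_norm_le_const (C := 1) (.of_forall fun ω => ?_)).trans (by simp)
    simp [Complex.norm_exp]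
  rw [h] at h1
  simpa [Rectangle.area] using h1

lemma re_exponent_neg (hL : IsLevySheet L Ψ P) (ξ : ℝ) : (Ψ (-ξ)).re = (Ψ ξ).re := by
  have h := hL.norm_integral_exp_rectangle ⟨0, 1, 0, 1, zero_lt_one, zero_lt_one⟩ ξ
  have h' := hL.norm_integral_exp_rectangle ⟨0, 1, 0, 1, zero_lt_one, zero_lt_one⟩ (-ξ)
  rw [← Complex.norm_conj, ← integral_conj] at h'
  simp_rw [← Complex.exp_conj] at h'
  simp only [map_mul, Complex.conj_I, Complex.conj_ofReal, Complex.ofReal_neg, mul_neg, neg_mul,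
    neg_neg, map_neg] at h'
  rw [h] at h'
  simpa [Rectangle.area] using h'.symm

/-- Independence of the increments over disjoint half-open boxes, in terms of moduli of
characteristic functions. Boxes that degenerate to the empty set are allowed. -/
lemma norm_integral_exp_sum_increment (hL : IsLevySheet L Ψ P) {ι : Type*} [Fintype ι]
    (a a' b b' : ι → ℝ≥0) (ha : ∀ k, a k ≤ a' k) (hb : ∀ k, b k ≤ b' k)
    (hdisj : Pairwise fun k l => Disjoint (Set.Ioc (a k) (a' k) ×ˢ Set.Ioc (b k) (b' k))
      (Set.Ioc (a l) (a' l) ×ˢ Set.Ioc (b l) (b' l))) (c : ι → ℝ) :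
    ‖∫ ω, Complex.exp (Complex.I *
        ((∑ k, c k * increment (fun x y => L x y ω) (a k) (b k) (a' k) (b' k) : ℝ) : ℂ)) ∂P‖ =
      Real.exp (-∑ k, ((a' k : ℝ) - a k) * ((b' k : ℝ) - b k) * (Ψ (c k)).re) := by
  classical
  -- The degenerate boxes contribute nothing to either side; the others are enumerated by a `Fin n`,
  -- as in the independence axiom.
  let p : ι → Prop := fun k => a k < a' k ∧ b k < b' k
  have hinc : ∀ k, ¬ p k → ∀ ω,
      increment (fun x y => L x y ω) (a k) (b k) (a' k) (b' k) = 0 := by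
    intro k hk ω
    rcases (not_and_or.1 hk) with h | h
    · simp [increment, le_antisymm (ha k) (not_lt.1 h)]
    · simp [increment, le_antisymm (hb k) (not_lt.1 h)]
  have hz : ∀ k, ¬ p k → ((a' k : ℝ) - a k) * ((b' k : ℝ) - b k) * (Ψ (c k)).re = 0 := by
    intro k hk
    rcases (not_and_or.1 hk) with h | h
    · simp [le_antisymm (ha k) (not_lt.1 h)]
    · simp [le_antisymm (hb k) (not_lt.1 h)]
  let e : Fin (Fintype.card {k // p k}) ≃ {k // p k} := (Fintype.equivFin _).symm
  let Q : Fin (Fintype.card {k // p k}) → Rectangle := fun i =>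
    ⟨a (e i), a' (e i), b (e i), b' (e i), (e i).2.1, (e i).2.2⟩
  have hQ : Pairwise fun i j => Disjoint (Q i).toSet (Q j).toSet := fun i j hij =>
    hdisj fun h => hij (e.injective (Subtype.ext h))
  have hsum : ∀ f : ι → ℝ, (∀ k, ¬ p k → f k = 0) → ∑ k, f k = ∑ i, f (e i) := by
    intro f hf
    rw [e.sum_comp fun k : {k // p k} => f k, ← Finset.sum_filter_of_ne (p := p)
      (fun k _ hk => by by_contra h; exact hk (hf k h))]
    exact Finset.sum_subtype _ (by simp) _
  have h1 : ∀ ω, Complex.exp (Complex.I *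
      ((∑ k, c k * increment (fun x y => L x y ω) (a k) (b k) (a' k) (b' k) : ℝ) : ℂ)) =
      ∏ i, Complex.exp (Complex.I * (c (e i) : ℂ) * ((Q i).incr L ω : ℝ)) := by
    intro ω
    rw [hsum _ fun k hk => by rw [hinc k hk, mul_zero], ← Complex.exp_sum]
    congr 1
    push_cast
    rw [Finset.mul_sum]
    exact Finset.sum_congr rfl fun i _ => by rw [mul_assoc]; rfl
  simp_rw [h1]
  rw [(hL.indep_increments _ Q hQ).integral_fun_prod_comp
    (f := fun i (x : ℝ) => Complex.exp (Complex.I * (c (e i) : ℂ) * (x : ℂ)))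
    (fun i => (hL.measurable_increment _ _ _ _).aemeasurable)
    (fun i => by fun_prop), norm_prod]
  simp_rw [hL.norm_integral_exp_rectangle]
  rw [← Real.exp_sum, hsum _ hz, Finset.sum_neg_distrib]
  rfl

/-- The modulus of the characteristic function of `∑ₖ cₖ L(pₖ)`, for points `pₖ` on a grid: the
cell `(i, j)` of the grid carries the sum of the `cₖ` over those `k` for which `pₖ` dominates the
cell. -/
lemma norm_integral_exp_grid (hL : IsLevySheet L Ψ P) {κ : Type*} [Fintype κ]
    (U V : ℕ → ℝ≥0) (hU : Monotone U) (hV : Monotone V) (hU0 : U 0 = 0) (hV0 : V 0 = 0)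
    (N : ℕ) (r s : κ → ℕ) (hr : ∀ k, r k ≤ N) (hs : ∀ k, s k ≤ N) (c : κ → ℝ) :
    ‖∫ ω, Complex.exp (Complex.I * ((∑ k, c k * L (U (r k)) (V (s k)) ω : ℝ) : ℂ)) ∂P‖ =
      Real.exp (-∑ q : Fin N × Fin N, ((U (q.1 + 1) : ℝ) - U q.1) * ((V (q.2 + 1) : ℝ) - V q.2) *
        (Ψ (∑ k, if (q.1 : ℕ) < r k ∧ (q.2 : ℕ) < s k then c k else 0)).re) := by
  classical
  rw [← hL.norm_integral_exp_sum_increment (fun q : Fin N × Fin N => U q.1) (fun q => U (q.1 + 1))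
    (fun q => V q.2) (fun q => V (q.2 + 1)) (fun q => hU (Nat.le_succ _))
    (fun q => hV (Nat.le_succ _))]
  · congr 1
    apply integral_congr_ae
    have hx : ∀ᵐ ω ∂P, ∀ k, L (U (r k)) 0 ω = 0 := ae_all_iff.2 fun k => hL.axis_right _
    have hy : ∀ᵐ ω ∂P, ∀ k, L 0 (V (s k)) ω = 0 := ae_all_iff.2 fun k => hL.axis_left _
    filter_upwards [hx, hy, hL.axis_left 0] with ω h1 h2 h3
    congr 3
    have hk : ∀ k, L (U (r k)) (V (s k)) ω = ∑ q : Fin N × Fin N,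
        if (q.1 : ℕ) < r k ∧ (q.2 : ℕ) < s k then
          increment (fun x y => L x y ω) (U q.1) (V q.2) (U (q.1 + 1)) (V (q.2 + 1)) else 0 := by
      intro k
      have h4 := sum_increment_grid (fun x y => L x y ω) U V (r k) (s k)
      rw [show increment (fun x y => L x y ω) (U 0) (V 0) (U (r k)) (V (s k)) =
        L (U (r k)) (V (s k)) ω by simp [increment, hU0, hV0, h1 k, h2 k, h3]] at h4
      rw [← h4, Fintype.sum_prod_type]
      have h5 : ∀ (m : ℕ) (_ : m ≤ N) (g : ℕ → ℝ),
          ∑ i ∈ Finset.range m, g i = ∑ i : Fin N, if (i : ℕ) < m then g i else 0 := by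
        intro m hm g
        rw [Fin.sum_univ_eq_sum_range (fun i => if i < m then g i else 0) N, ← Finset.sum_filter]
        congr 1
        ext i
        simp only [Finset.mem_range, Finset.mem_filter]
        omega
      rw [h5 _ (hr k)]
      refine Finset.sum_congr rfl fun i _ => ?_
      rw [h5 _ (hs k)]
      by_cases h : (i : ℕ) < r k <;> simp [h]
    simp_rw [hk, Finset.mul_sum, Finset.sum_mul]
    rw [Finset.sum_comm]
    refine Finset.sum_congr rfl fun q _ => Finset.sum_congr rfl fun k _ => ?_
    split_ifs <;> simp
  · intro q q' hq
    have key : ∀ {W : ℕ → ℝ≥0}, Monotone W → ∀ {i j : ℕ}, i ≠ j →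
        Disjoint (Set.Ioc (W i) (W (i + 1))) (Set.Ioc (W j) (W (j + 1))) := fun hW i j hij =>
      hW.pairwise_disjoint_on_Ioc_succ hij
    rw [Set.disjoint_prod]
    by_contra h
    push Not at h
    apply hq
    ext
    · by_contra h'; exact h.1 (key hU h')
    · by_contra h'; exact h.2 (key hV h')

end IsLevySheet

/-- The alternating signs `+, -, +, -` of the four phases in `|Z|⁴ = Z Z̄ Z Z̄`. -/
def altSign (k : Fin 4) : ℤ := (-1) ^ (k : ℕ)

/-- Since the signs add up to zero, removing one of them, or all but one, leaves `±1`. -/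
lemma sum_altSign_eq_one_or (e : Equiv.Perm (Fin 4)) :
    ((∑ k, if 1 < (e k : ℕ) + 1 then altSign k else 0) = 1 ∨
      (∑ k, if 1 < (e k : ℕ) + 1 then altSign k else 0) = -1) ∧
    ((∑ k, if 3 < (e k : ℕ) + 1 then altSign k else 0) = 1 ∨
      (∑ k, if 3 < (e k : ℕ) + 1 then altSign k else 0) = -1) := by
  revert e; decide

/-- The sequence `0, f 0, f 1, f 2, f 3, f 3, …` of grid lines. -/
def gridLines (f : Fin 4 → ℝ≥0) : ℕ → ℝ≥0
  | 0 => 0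
  | m + 1 => f ⟨min m 3, by omega⟩

lemma gridLines_succ (f : Fin 4 → ℝ≥0) (i : Fin 4) : gridLines f ((i : ℕ) + 1) = f i := by
  have : min (i : ℕ) 3 = i := by omega
  simp [gridLines, this]

lemma monotone_gridLines {f : Fin 4 → ℝ≥0} (hf : Monotone f) : Monotone (gridLines f) := by
  refine monotone_nat_of_le_succ fun n => ?_
  cases n with
  | zero => exact zero_le
  | succ m => exact hf (Fin.mk_le_mk.2 (by omega))

/-- The sum of `exp (-c (|x₀ - x₁| + |x₂ - x₃|))` over all permutations of the four coordinates. It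
dominates the term that belongs to the increasing order of the coordinates. -/
noncomputable def pairSum (c : ℝ) (x : Fin 4 → ℝ) : ℝ :=
  ∑ σ : Equiv.Perm (Fin 4), Real.exp (-(c * |x (σ 0) - x (σ 1)|)) *
    Real.exp (-(c * |x (σ 2) - x (σ 3)|))

lemma pairSum_nonneg (c : ℝ) (x : Fin 4 → ℝ) : 0 ≤ pairSum c x :=
  Finset.sum_nonneg fun _ _ => by positivity

lemma pairSum_le {c : ℝ} (hc : 0 ≤ c) (x : Fin 4 → ℝ) : pairSum c x ≤ 24 := by
  have h : ∀ σ : Equiv.Perm (Fin 4), Real.exp (-(c * |x (σ 0) - x (σ 1)|)) *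
      Real.exp (-(c * |x (σ 2) - x (σ 3)|)) ≤ 1 := by
    intro σ
    rw [← Real.exp_add, Real.exp_le_one_iff]
    have := mul_nonneg hc (abs_nonneg (x (σ 0) - x (σ 1)))
    have := mul_nonneg hc (abs_nonneg (x (σ 2) - x (σ 3)))
    linarith
  refine (Finset.sum_le_sum fun σ _ => h σ).trans (le_of_eq ?_)
  rw [Finset.sum_const, Finset.card_univ, Fintype.card_perm, Fintype.card_fin, nsmul_eq_mul]
  norm_num [Nat.factorial]

lemma measurable_pairSum (c : ℝ) : Measurable (pairSum c) := by
  unfold pairSum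
  fun_prop

namespace IsLevySheet

variable {Ω : Type*} [MeasurableSpace Ω] {P : Measure Ω} {L : ℝ≥0 → ℝ≥0 → Ω → ℝ} {Ψ : ℝ → ℂ}

/-- The four-point estimate. Order the abscissas by `σ` and the ordinates by `τ`. In the grid they
span, the cells `(0, 1)`, `(0, 3)`, `(1, 0)`, `(3, 0)` lie below three or one of the points, so that
the sheet increment over each of them enters with coefficient `±θ`. -/
theorem norm_integral_exp_four_points [IsProbabilityMeasure P] (hL : IsLevySheet L Ψ P) (θ : ℝ)
    (x y : Fin 4 → ℝ≥0) (σ τ : Equiv.Perm (Fin 4)) (hσ : Monotone (x ∘ σ))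
    (hτ : Monotone (y ∘ τ)) :
    ‖∫ ω, Complex.exp (Complex.I *
        ((∑ k, θ * (altSign k : ℝ) * L (x k) (y k) ω : ℝ) : ℂ)) ∂P‖ ≤
      Real.exp (-((Ψ θ).re * ((x (σ 0) : ℝ) * ((y (τ 1) - y (τ 0)) + (y (τ 3) - y (τ 2))) +
        (y (τ 0) : ℝ) * ((x (σ 1) - x (σ 0)) + (x (σ 3) - x (σ 2)))))) := by
  have hx : ∀ k, gridLines (x ∘ σ) ((σ.symm k : ℕ) + 1) = x k := fun k => by
    simp [gridLines_succ]
  have hy : ∀ k, gridLines (y ∘ τ) ((τ.symm k : ℕ) + 1) = y k := fun k => by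
    simp [gridLines_succ]
  have h := hL.norm_integral_exp_grid (gridLines (x ∘ σ)) (gridLines (y ∘ τ))
    (monotone_gridLines hσ) (monotone_gridLines hτ) rfl rfl 4 (fun k : Fin 4 => (σ.symm k : ℕ) + 1)
    (fun k => (τ.symm k : ℕ) + 1) (fun k => by omega) (fun k => by omega)
    (fun k => θ * (altSign k : ℝ))
  simp_rw [hx, hy] at h
  rw [h]
  refine Real.exp_le_exp.2 (neg_le_neg ?_)
  set G : Fin 4 × Fin 4 → ℝ := fun q =>
    ((gridLines (x ∘ σ) (q.1 + 1) : ℝ) - gridLines (x ∘ σ) q.1) *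
      ((gridLines (y ∘ τ) (q.2 + 1) : ℝ) - gridLines (y ∘ τ) q.2) *
      (Ψ (∑ k, if (q.1 : ℕ) < (σ.symm k : ℕ) + 1 ∧ (q.2 : ℕ) < (τ.symm k : ℕ) + 1
        then θ * (altSign k : ℝ) else 0)).re with hG
  have hnonneg : ∀ q, 0 ≤ G q := fun q => mul_nonneg (mul_nonneg
    (sub_nonneg.2 (NNReal.coe_le_coe.2 (monotone_gridLines hσ (Nat.le_succ _))))
    (sub_nonneg.2 (NNReal.coe_le_coe.2 (monotone_gridLines hτ (Nat.le_succ _)))))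
    (hL.re_exponent_nonneg _)
  -- Below the cells `(0, m)` and `(m, 0)` one coordinate imposes no condition, so only the order of
  -- the points in the other coordinate matters.
  have hcoef : ∀ (e : Equiv.Perm (Fin 4)) (m : ℕ), m = 1 ∨ m = 3 →
      (Ψ (∑ k, if m < (e k : ℕ) + 1 then θ * (altSign k : ℝ) else 0)).re = (Ψ θ).re := by
    intro e m hm
    have h1 : (∑ k, if m < (e k : ℕ) + 1 then θ * (altSign k : ℝ) else 0) =
        θ * ((∑ k, if m < (e k : ℕ) + 1 then altSign k else 0 : ℤ) : ℝ) := by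
      push_cast
      rw [Finset.mul_sum]
      exact Finset.sum_congr rfl fun k _ => by split_ifs <;> simp
    rw [h1]
    rcases hm with rfl | rfl
    · rcases (sum_altSign_eq_one_or e).1 with h2 | h2 <;> rw [h2] <;> simp [hL.re_exponent_neg]
    · rcases (sum_altSign_eq_one_or e).2 with h2 | h2 <;> rw [h2] <;> simp [hL.re_exponent_neg]
  have hrow : ∀ j : Fin 4, (j : ℕ) = 1 ∨ (j : ℕ) = 3 → G (0, j) = (x (σ 0) : ℝ) *
      ((gridLines (y ∘ τ) (j + 1) : ℝ) - gridLines (y ∘ τ) j) * (Ψ θ).re := by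
    intro j hj
    have h1 : (x (σ 0) : ℝ) = gridLines (x ∘ σ) 1 - gridLines (x ∘ σ) 0 := by simp [gridLines]
    rw [← hcoef τ.symm j hj, h1]
    refine congrArg (fun z => _ * (Ψ z).re) (Finset.sum_congr rfl fun k _ => ?_)
    exact if_congr ⟨fun h => h.2, fun h => ⟨Nat.succ_pos _, h⟩⟩ rfl rfl
  have hcol : ∀ i : Fin 4, (i : ℕ) = 1 ∨ (i : ℕ) = 3 → G (i, 0) =
      ((gridLines (x ∘ σ) (i + 1) : ℝ) - gridLines (x ∘ σ) i) * (y (τ 0) : ℝ) * (Ψ θ).re := by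
    intro i hi
    have h1 : (y (τ 0) : ℝ) = gridLines (y ∘ τ) 1 - gridLines (y ∘ τ) 0 := by simp [gridLines]
    rw [← hcoef σ.symm i hi, h1]
    refine congrArg (fun z => _ * (Ψ z).re) (Finset.sum_congr rfl fun k _ => ?_)
    exact if_congr ⟨fun h => h.1, fun h => ⟨h, Nat.succ_pos _⟩⟩ rfl rfl
  have h01 : G (0, 1) = x (σ 0) * (y (τ 1) - y (τ 0)) * (Ψ θ).re := hrow 1 (.inl rfl)
  have h03 : G (0, 3) = x (σ 0) * (y (τ 3) - y (τ 2)) * (Ψ θ).re := hrow 3 (.inr rfl)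
  have h10 : G (1, 0) = (x (σ 1) - x (σ 0)) * y (τ 0) * (Ψ θ).re := hcol 1 (.inl rfl)
  have h30 : G (3, 0) = (x (σ 3) - x (σ 2)) * y (τ 0) * (Ψ θ).re := hcol 3 (.inr rfl)
  calc _ = G (0, 1) + G (0, 3) + G (1, 0) + G (3, 0) := by rw [h01, h03, h10, h30]; ring
    _ = ∑ q ∈ ({(0, 1), (0, 3), (1, 0), (3, 0)} : Finset (Fin 4 × Fin 4)), G q := by
      rw [Finset.sum_insert (by decide), Finset.sum_insert (by decide),
        Finset.sum_insert (by decide), Finset.sum_singleton]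
      ring
    _ ≤ ∑ q, G q := Finset.sum_le_sum_of_subset_of_nonneg (Finset.subset_univ _)
      fun q _ _ => hnonneg q

/-- For points of the box `[α, ∞) × [γ, ∞)` the four-point estimate is dominated by a product of a
function of the abscissas and a function of the ordinates. -/
theorem norm_integral_exp_four_points_le_mul [IsProbabilityMeasure P] (hL : IsLevySheet L Ψ P)
    (θ : ℝ) (x y : Fin 4 → ℝ≥0) {α γ : ℝ} (hx : ∀ k, α ≤ x k)
    (hy : ∀ k, γ ≤ y k) :
    ‖∫ ω, Complex.exp (Complex.I *
        ((∑ k, θ * (altSign k : ℝ) * L (x k) (y k) ω : ℝ) : ℂ)) ∂P‖ ≤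
      pairSum ((Ψ θ).re * γ) (fun k => x k) * pairSum ((Ψ θ).re * α) (fun k => y k) := by
  have ha := hL.re_exponent_nonneg θ
  have hσ := Tuple.monotone_sort x
  have hτ := Tuple.monotone_sort y
  set σ := Tuple.sort x
  set τ := Tuple.sort y
  have e1 : (x (σ 0) : ℝ) ≤ x (σ 1) := NNReal.coe_le_coe.2 (hσ (by decide : (0 : Fin 4) ≤ 1))
  have e2 : (x (σ 2) : ℝ) ≤ x (σ 3) := NNReal.coe_le_coe.2 (hσ (by decide : (2 : Fin 4) ≤ 3))
  have e3 : (y (τ 0) : ℝ) ≤ y (τ 1) := NNReal.coe_le_coe.2 (hτ (by decide : (0 : Fin 4) ≤ 1))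
  have e4 : (y (τ 2) : ℝ) ≤ y (τ 3) := NNReal.coe_le_coe.2 (hτ (by decide : (2 : Fin 4) ≤ 3))
  refine (hL.norm_integral_exp_four_points θ x y σ τ hσ hτ).trans ?_
  refine le_trans ?_ (mul_le_mul
    (Finset.single_le_sum (fun _ _ => by positivity) (Finset.mem_univ σ))
    (Finset.single_le_sum (fun _ _ => by positivity) (Finset.mem_univ τ))
    (by positivity) (pairSum_nonneg _ _))
  rw [← Real.exp_add, ← Real.exp_add, ← Real.exp_add, Real.exp_le_exp,
    abs_of_nonpos (by linarith), abs_of_nonpos (by linarith), abs_of_nonpos (by linarith),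
    abs_of_nonpos (by linarith)]
  have k1 := mul_le_mul_of_nonneg_right (hx (σ 0))
    (by linarith : (0 : ℝ) ≤ (y (τ 1) - y (τ 0)) + (y (τ 3) - y (τ 2)))
  have k2 := mul_le_mul_of_nonneg_right (hy (τ 0))
    (by linarith : (0 : ℝ) ≤ (x (σ 1) - x (σ 0)) + (x (σ 3) - x (σ 2)))
  have k3 := mul_le_mul_of_nonneg_left (add_le_add k1 k2) ha
  linarith

end IsLevySheet

/-! ### Integrals of products of exponentials -/

lemma integral_exp_neg_mul_abs_sub {c : ℝ} (hc : 0 < c) (x₀ : ℝ) :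
    ∫ x : ℝ, Real.exp (-(c * |x₀ - x|)) = 2 / c := by
  have h := integral_comp_abs (f := fun x : ℝ => Real.exp (-c * x))
  rw [integral_exp_mul_Ioi (by linarith) 0] at h
  rw [integral_sub_left_eq_self (fun x : ℝ => Real.exp (-(c * |x|))) volume x₀]
  simp only [neg_mul, mul_zero, Real.exp_zero] at h
  rw [h, neg_div_neg_eq, mul_one_div]

lemma integral_integral_exp_neg_mul_abs_sub_le {c : ℝ} (hc : 0 < c) {α β : ℝ} (hαβ : α ≤ β) :
    ∫ x in Set.Ioc α β, ∫ y in Set.Ioc α β, Real.exp (-(c * |x - y|)) ≤ 2 / c * (β - α) := by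
  have h : ∀ x : ℝ, ‖∫ y in Set.Ioc α β, Real.exp (-(c * |x - y|))‖ ≤ 2 / c := by
    intro x
    rw [← integral_exp_neg_mul_abs_sub hc x, Real.norm_of_nonneg (by positivity)]
    refine setIntegral_le_integral (Integrable.of_integral_ne_zero ?_)
      (.of_forall fun _ => (Real.exp_pos _).le)
    rw [integral_exp_neg_mul_abs_sub hc]
    positivity
  refine (Real.le_norm_self _).trans ((norm_integral_le_of_norm_le_const (.of_forall h)).trans ?_)
  simp [hαβ]

lemma integral_pi_exp_pair {c : ℝ} (hc : 0 < c) {α β : ℝ} (hαβ : α ≤ β)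
    (σ : Equiv.Perm (Fin 4)) :
    ∫ x : Fin 4 → ℝ, Real.exp (-(c * |x (σ 0) - x (σ 1)|)) * Real.exp (-(c * |x (σ 2) - x (σ 3)|))
      ∂(Measure.pi fun _ => volume.restrict (Set.Ioc α β)) ≤ (2 / c * (β - α)) ^ 2 := by
  set μ : Measure ℝ := volume.restrict (Set.Ioc α β)
  let e : Fin 2 ⊕ Fin 2 ≃ Fin 4 := finSumFinEquiv.trans σ
  have m1 := measurePreserving_piCongrLeft (fun _ : Fin 4 => μ) e
  have m2 := measurePreserving_sumPiEquivProdPi_symm (fun _ : Fin 2 ⊕ Fin 2 => μ)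
  have m3 := measurePreserving_piFinTwo (fun _ : Fin 2 => μ)
  rw [← m1.integral_comp' (g := fun x : Fin 4 → ℝ => Real.exp (-(c * |x (σ 0) - x (σ 1)|)) *
    Real.exp (-(c * |x (σ 2) - x (σ 3)|)))]
  have hval : ∀ (s : Fin 2 ⊕ Fin 2) (x : Fin 2 ⊕ Fin 2 → ℝ),
      (MeasurableEquiv.piCongrLeft (fun _ : Fin 4 => ℝ) e) x (e s) = x s := fun s x => by
    rw [MeasurableEquiv.coe_piCongrLeft, Equiv.piCongrLeft_apply_apply]
  simp_rw [show σ 0 = e (.inl 0) from rfl, show σ 1 = e (.inl 1) from rfl,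
    show σ 2 = e (.inr 0) from rfl, show σ 3 = e (.inr 1) from rfl, hval]
  rw [← m2.integral_comp' (g := fun x : Fin 2 ⊕ Fin 2 → ℝ =>
    Real.exp (-(c * |x (.inl 0) - x (.inl 1)|)) * Real.exp (-(c * |x (.inr 0) - x (.inr 1)|)))]
  have h4 := integral_prod_mul (μ := Measure.pi fun _ : Fin 2 => μ)
    (ν := Measure.pi fun _ : Fin 2 => μ) (fun u : Fin 2 → ℝ => Real.exp (-(c * |u 0 - u 1|)))
    (fun u : Fin 2 → ℝ => Real.exp (-(c * |u 0 - u 1|)))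
  refine h4.le.trans ?_
  have h5 : ∫ u : Fin 2 → ℝ, Real.exp (-(c * |u 0 - u 1|)) ∂(Measure.pi fun _ : Fin 2 => μ) ≤
      2 / c * (β - α) := by
    refine le_trans (le_of_eq ?_) (integral_integral_exp_neg_mul_abs_sub_le hc hαβ)
    refine (m3.integral_comp' (g := fun p : ℝ × ℝ => Real.exp (-(c * |p.1 - p.2|)))).trans ?_
    refine integral_prod _ ?_
    refine Integrable.of_bound (C := 1) (by fun_prop) (.of_forall fun p => ?_)
    rw [Real.norm_eq_abs, Real.abs_exp, Real.exp_le_one_iff, neg_nonpos]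
    positivity
  have h6 : 0 ≤ ∫ u : Fin 2 → ℝ, Real.exp (-(c * |u 0 - u 1|))
      ∂(Measure.pi fun _ : Fin 2 => μ) := integral_nonneg fun _ => (Real.exp_pos _).le
  rw [sq]
  exact mul_le_mul h5 h5 h6 (h6.trans h5)

lemma integral_pairSum_le {c : ℝ} (hc : 0 < c) {α β : ℝ} (hαβ : α ≤ β) :
    ∫ x : Fin 4 → ℝ, pairSum c x ∂(Measure.pi fun _ => volume.restrict (Set.Ioc α β)) ≤
      24 * (2 / c * (β - α)) ^ 2 := by
  unfold pairSum
  rw [integral_finsetSum]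
  · refine (Finset.sum_le_sum fun σ _ => integral_pi_exp_pair hc hαβ σ).trans (le_of_eq ?_)
    rw [Finset.sum_const, Finset.card_univ, Fintype.card_perm, Fintype.card_fin, nsmul_eq_mul]
    norm_num [Nat.factorial]
  · intro σ _
    refine Integrable.of_bound (C := 1) (by fun_prop) (.of_forall fun x => ?_)
    rw [← Real.exp_add, Real.norm_eq_abs, Real.abs_exp, Real.exp_le_one_iff]
    have := mul_nonneg hc.le (abs_nonneg (x (σ 0) - x (σ 1)))
    have := mul_nonneg hc.le (abs_nonneg (x (σ 2) - x (σ 3)))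
    linarith

/-! ### Fourth moments over boxes away from the axes -/

variable {Ω : Type*} {L : ℝ≥0 → ℝ≥0 → Ω → ℝ} {θ : ℝ}

/-- The integrand `√(xy) e^{iθL(x,y)}` of `approxField`. -/
noncomputable def weightedPhase (L : ℝ≥0 → ℝ≥0 → Ω → ℝ) (θ x y : ℝ) (ω : Ω) : ℂ :=
  (√(x * y) : ℂ) *
    ((Real.cos (θ * L x.toNNReal y.toNNReal ω) : ℂ) +
      Complex.I * (Real.sin (θ * L x.toNNReal y.toNNReal ω) : ℂ))

/-- The integral of `weightedPhase` over the box with corners `(α, γ)` and `(β, δ)`; up to a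
constant factor the increments of `approxField` are of this form. -/
noncomputable def boxIntegral (L : ℝ≥0 → ℝ≥0 → Ω → ℝ) (θ α β γ δ : ℝ) (ω : Ω) : ℂ :=
  ∫ y in γ..δ, ∫ x in α..β, weightedPhase L θ x y ω

lemma weightedPhase_eq (x y : ℝ) (ω : Ω) : weightedPhase L θ x y ω =
    (√(x * y) : ℂ) * Complex.exp (Complex.I * ((θ * L x.toNNReal y.toNNReal ω : ℝ) : ℂ)) := by
  rw [weightedPhase, mul_comm Complex.I ((θ * L x.toNNReal y.toNNReal ω : ℝ) : ℂ),
    Complex.exp_mul_I, Complex.ofReal_cos, Complex.ofReal_sin, mul_comm Complex.I]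

lemma norm_weightedPhase (x y : ℝ) (ω : Ω) : ‖weightedPhase L θ x y ω‖ = √(x * y) := by
  rw [weightedPhase_eq, norm_mul, mul_comm Complex.I, Complex.norm_exp_ofReal_mul_I, mul_one,
    Complex.norm_real, Real.norm_of_nonneg (Real.sqrt_nonneg _)]

lemma norm_weightedPhase_le {x y B : ℝ} (hx : |x| ≤ B) (hy : |y| ≤ B) (ω : Ω) :
    ‖weightedPhase L θ x y ω‖ ≤ B := by
  rw [norm_weightedPhase]
  refine Real.sqrt_le_iff.2 ⟨(abs_nonneg x).trans hx, ?_⟩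
  rw [sq]
  exact (le_abs_self _).trans ((abs_mul x y).le.trans
    (mul_le_mul hx hy (abs_nonneg _) ((abs_nonneg x).trans hx)))

variable [MeasurableSpace Ω] {P : Measure Ω} {Ψ : ℝ → ℂ}

lemma measurable_weightedPhase (hL : Measurable fun p : (ℝ≥0 × ℝ≥0) × Ω => L p.1.1 p.1.2 p.2) :
    Measurable fun p : (ℝ × ℝ) × Ω => weightedPhase L θ p.1.1 p.1.2 p.2 := by
  have h : Measurable fun p : (ℝ × ℝ) × Ω => L p.1.1.toNNReal p.1.2.toNNReal p.2 :=
    hL.comp (f := fun p : (ℝ × ℝ) × Ω => ((p.1.1.toNNReal, p.1.2.toNNReal), p.2)) (by fun_prop)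
  have h1 : Measurable fun p : (ℝ × ℝ) × Ω => √(p.1.1 * p.1.2) := by fun_prop
  exact (Complex.measurable_ofReal.comp h1).mul
    ((Complex.measurable_ofReal.comp (Real.measurable_cos.comp (h.const_mul θ))).add
      ((Complex.measurable_ofReal.comp (Real.measurable_sin.comp (h.const_mul θ))).const_mul
        Complex.I))

/-- Lebesgue measure on the box `(α, β] × (γ, δ]`. -/
noncomputable abbrev boxMeasure (α β γ δ : ℝ) : Measure (ℝ × ℝ) :=
  (volume.restrict (Set.Ioc α β)).prod (volume.restrict (Set.Ioc γ δ))

lemma ae_mem_box (α β γ δ : ℝ) :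
    ∀ᵐ z ∂(boxMeasure α β γ δ), z.1 ∈ Set.Ioc α β ∧ z.2 ∈ Set.Ioc γ δ := by
  rw [boxMeasure, Measure.prod_restrict]
  exact ae_restrict_mem (measurableSet_Ioc.prod measurableSet_Ioc)

lemma boxIntegral_eq_integral (hL : Measurable fun p : (ℝ≥0 × ℝ≥0) × Ω => L p.1.1 p.1.2 p.2)
    {α β γ δ : ℝ} (hαβ : α ≤ β) (hγδ : γ ≤ δ) (ω : Ω) :
    boxIntegral L θ α β γ δ ω = ∫ z, weightedPhase L θ z.1 z.2 ω ∂(boxMeasure α β γ δ) := by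
  rw [boxIntegral, intervalIntegral.integral_of_le hγδ]
  simp_rw [intervalIntegral.integral_of_le hαβ]
  rw [integral_prod_symm]
  have hm : Measurable fun z : ℝ × ℝ => weightedPhase L θ z.1 z.2 ω :=
    (measurable_weightedPhase hL).comp (measurable_id.prodMk measurable_const)
  refine Integrable.of_bound (C := max (max |α| |β|) (max |γ| |δ|)) hm.aestronglyMeasurable ?_
  filter_upwards [ae_mem_box α β γ δ] with z hz
  refine norm_weightedPhase_le ?_ ?_ ω
  · exact (abs_le_max_abs_abs hz.1.1.le hz.1.2).trans (le_max_left _ _)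
  · exact (abs_le_max_abs_abs hz.2.1.le hz.2.2).trans (le_max_right _ _)

lemma prod_alternating_conj (z : ℂ) :
    ∏ k : Fin 4, (if altSign k = 1 then z else (starRingEnd ℂ) z) = ((‖z‖ ^ 4 : ℝ) : ℂ) := by
  rw [Fin.prod_univ_four, if_pos (by decide), if_neg (by decide), if_pos (by decide),
    if_neg (by decide), mul_assoc (z * _), Complex.mul_conj']
  push_cast
  ring

/-- The fourth moment of a box integral as an integral over quadruples of points. -/
lemma integral_norm_pow_four_eq [IsProbabilityMeasure P]
    (hL : Measurable fun p : (ℝ≥0 × ℝ≥0) × Ω => L p.1.1 p.1.2 p.2)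
    {α β γ δ : ℝ} (hαβ : α ≤ β) (hγδ : γ ≤ δ) :
    ((∫ ω, ‖boxIntegral L θ α β γ δ ω‖ ^ 4 ∂P : ℝ) : ℂ) =
      ∫ z : Fin 4 → ℝ × ℝ, (∏ k, √((z k).1 * (z k).2) : ℝ) *
        ∫ ω, Complex.exp (Complex.I * ((∑ k, θ * (altSign k : ℝ) *
          L (z k).1.toNNReal (z k).2.toNNReal ω : ℝ) : ℂ)) ∂P
        ∂(Measure.pi fun _ => boxMeasure α β γ δ) := by
  set ν := boxMeasure α β γ δ with hν
  let F : Fin 4 → ℝ × ℝ → Ω → ℂ := fun k z ω =>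
    (√(z.1 * z.2) : ℂ) * Complex.exp (Complex.I * ((θ * (altSign k : ℝ) *
      L z.1.toNNReal z.2.toNNReal ω : ℝ) : ℂ))
  have hF : ∀ k z ω, F k z ω = if altSign k = 1 then weightedPhase L θ z.1 z.2 ω
      else (starRingEnd ℂ) (weightedPhase L θ z.1 z.2 ω) := by
    intro k z ω
    have hk : altSign k = 1 ∨ altSign k = -1 := by revert k; decide
    rcases hk with hk | hk
    · simp [F, hk, weightedPhase_eq]
    · simp only [F, hk, weightedPhase_eq, map_mul, Complex.conj_ofReal, ← Complex.exp_conj,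
        Complex.conj_I]
      norm_num
  have hFint : ∀ k ω, ∫ z, F k z ω ∂ν = if altSign k = 1 then boxIntegral L θ α β γ δ ω
      else (starRingEnd ℂ) (boxIntegral L θ α β γ δ ω) := by
    intro k ω
    simp_rw [hF, boxIntegral_eq_integral hL hαβ hγδ]
    split_ifs
    · rfl
    · exact integral_conj
  have hprod : ∀ (z : Fin 4 → ℝ × ℝ) (ω : Ω), ∏ k, F k (z k) ω =
      (∏ k, √((z k).1 * (z k).2) : ℝ) * Complex.exp (Complex.I * ((∑ k, θ * (altSign k : ℝ) *
          L (z k).1.toNNReal (z k).2.toNNReal ω : ℝ) : ℂ)) := by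
    intro z ω
    rw [Finset.prod_mul_distrib, ← Complex.exp_sum, Complex.ofReal_prod, Complex.ofReal_sum,
      Finset.mul_sum]
  calc ((∫ ω, ‖boxIntegral L θ α β γ δ ω‖ ^ 4 ∂P : ℝ) : ℂ)
      = ∫ ω, ∏ k, ∫ z, F k z ω ∂ν ∂P := by
        rw [← integral_complex_ofReal]
        simp_rw [hFint, prod_alternating_conj]
    _ = ∫ ω, ∫ z : Fin 4 → ℝ × ℝ, ∏ k, F k (z k) ω ∂(Measure.pi fun _ => ν) ∂P := by
        refine integral_congr_ae (.of_forall fun ω => ?_)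
        exact (integral_fintype_prod_eq_prod (μ := fun _ : Fin 4 => ν) fun k z => F k z ω).symm
    _ = ∫ z : Fin 4 → ℝ × ℝ, ∫ ω, ∏ k, F k (z k) ω ∂P ∂(Measure.pi fun _ => ν) := by
        refine integral_integral_swap ?_
        have hm : Measurable (Function.uncurry fun (ω : Ω) (z : Fin 4 → ℝ × ℝ) =>
            ∏ k, F k (z k) ω) := by
          refine Finset.measurable_fun_prod _ fun k _ => ?_
          have h1 : Measurable fun p : Ω × (Fin 4 → ℝ × ℝ) =>
              weightedPhase L θ (p.2 k).1 (p.2 k).2 p.1 :=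
            (measurable_weightedPhase hL).comp
              (f := fun p : Ω × (Fin 4 → ℝ × ℝ) => (p.2 k, p.1)) (by fun_prop)
          simp only [hF]
          split_ifs
          · exact h1
          · exact Complex.continuous_conj.measurable.comp h1
        set B := max (max |α| |β|) (max |γ| |δ|)
        refine Integrable.of_bound (C := B ^ 4) hm.aestronglyMeasurable ?_
        have hae : ∀ᵐ z ∂(Measure.pi fun _ : Fin 4 => ν), ∀ k,
            (z k).1 ∈ Set.Ioc α β ∧ (z k).2 ∈ Set.Ioc γ δ := ae_all_iff.2 fun k =>
          (Measure.quasiMeasurePreserving_eval (fun _ : Fin 4 => ν) k).ae (ae_mem_box α β γ δ)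
        filter_upwards [Measure.quasiMeasurePreserving_snd.ae hae] with p hp
        have hk : ∀ k, ‖F k (p.2 k) p.1‖ ≤ B := by
          intro k
          have h1 : ‖weightedPhase L θ (p.2 k).1 (p.2 k).2 p.1‖ ≤ B := norm_weightedPhase_le
            ((abs_le_max_abs_abs (hp k).1.1.le (hp k).1.2).trans (le_max_left _ _))
            ((abs_le_max_abs_abs (hp k).2.1.le (hp k).2.2).trans (le_max_right _ _)) _
          rw [hF]
          split_ifs
          · exact h1
          · rwa [Complex.norm_conj]
        refine (norm_prod _ _).le.trans ((Finset.prod_le_prod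
          (fun _ _ => norm_nonneg _) fun k _ => hk k).trans ?_)
        simp
    _ = _ := by
        refine integral_congr_ae (.of_forall fun z => ?_)
        simp_rw [hprod]
        exact integral_const_mul _ _

/-- The fourth moment estimate for boxes whose sides are at most as long as their distances to the
axes: there the weights `√(xy)` are comparable to constants. -/
theorem IsLevySheet.integral_norm_boxIntegral_pow_four_le [IsProbabilityMeasure P]
    (hLs : IsLevySheet L Ψ P)
    (hL : Measurable fun p : (ℝ≥0 × ℝ≥0) × Ω => L p.1.1 p.1.2 p.2) (ha : 0 < (Ψ θ).re)
    {α β γ δ : ℝ} (hα : 0 < α) (hγ : 0 < γ) (hαβ : α ≤ β) (hγδ : γ ≤ δ) (hβ : β ≤ 2 * α)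
    (hδ : δ ≤ 2 * γ) :
    ∫ ω, ‖boxIntegral L θ α β γ δ ω‖ ^ 4 ∂P ≤
      384 ^ 2 / (Ψ θ).re ^ 4 * (β - α) ^ 2 * (δ - γ) ^ 2 := by
  set a := (Ψ θ).re
  set ν := boxMeasure α β γ δ
  have hβ0 : 0 < β := hα.trans_le hαβ
  have hδ0 : 0 < δ := hγ.trans_le hγδ
  have hae : ∀ᵐ z ∂(Measure.pi fun _ : Fin 4 => ν), ∀ k,
      (z k).1 ∈ Set.Ioc α β ∧ (z k).2 ∈ Set.Ioc γ δ := ae_all_iff.2 fun k =>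
    (Measure.quasiMeasurePreserving_eval (fun _ : Fin 4 => ν) k).ae (ae_mem_box α β γ δ)
  have hint : ∫ z : Fin 4 → ℝ × ℝ, (β * δ) ^ 2 *
      (pairSum (a * γ) (fun k => (z k).1) * pairSum (a * α) (fun k => (z k).2))
      ∂(Measure.pi fun _ => ν) = (β * δ) ^ 2 *
        ((∫ x, pairSum (a * γ) x ∂(Measure.pi fun _ => volume.restrict (Set.Ioc α β))) *
        ∫ y, pairSum (a * α) y ∂(Measure.pi fun _ => volume.restrict (Set.Ioc γ δ))) := by
    rw [integral_const_mul, ← integral_prod_mul, ← (measurePreserving_arrowProdEquivProdArrow ℝ ℝ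
      (Fin 4) (fun _ => volume.restrict (Set.Ioc α β))
      (fun _ => volume.restrict (Set.Ioc γ δ))).integral_comp']
    rfl
  have hmain : ‖((∫ ω, ‖boxIntegral L θ α β γ δ ω‖ ^ 4 ∂P : ℝ) : ℂ)‖ ≤
      ∫ z : Fin 4 → ℝ × ℝ, (β * δ) ^ 2 *
      (pairSum (a * γ) (fun k => (z k).1) * pairSum (a * α) (fun k => (z k).2))
        ∂(Measure.pi fun _ => ν) := by
    rw [integral_norm_pow_four_eq hL hαβ hγδ]
    refine norm_integral_le_of_norm_le ?_ ?_
    · refine Integrable.of_bound (C := (β * δ) ^ 2 * (24 * 24)) (Measurable.aestronglyMeasurable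
        (measurable_const.mul (((measurable_pairSum _).comp (by fun_prop)).mul
          ((measurable_pairSum _).comp (by fun_prop)))))
        (.of_forall fun z => ?_)
      rw [Real.norm_of_nonneg (mul_nonneg (by positivity)
        (mul_nonneg (pairSum_nonneg _ _) (pairSum_nonneg _ _)))]
      exact mul_le_mul_of_nonneg_left (mul_le_mul (pairSum_le (by positivity) _)
        (pairSum_le (by positivity) _) (pairSum_nonneg _ _) (by norm_num))
        (by positivity)
    · filter_upwards [hae] with z hz
      have hx : ∀ k, (((z k).1.toNNReal : ℝ≥0) : ℝ) = (z k).1 := fun k =>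
        Real.coe_toNNReal _ (hα.trans (hz k).1.1).le
      have hy : ∀ k, (((z k).2.toNNReal : ℝ≥0) : ℝ) = (z k).2 := fun k =>
        Real.coe_toNNReal _ (hγ.trans (hz k).2.1).le
      have h4 := hLs.norm_integral_exp_four_points_le_mul θ (fun k => (z k).1.toNNReal)
        (fun k => (z k).2.toNNReal) (α := α) (γ := γ) (fun k => by rw [hx]; exact (hz k).1.1.le)
        (fun k => by rw [hy]; exact (hz k).2.1.le)
      simp_rw [hx, hy] at h4
      rw [norm_mul, Complex.norm_real, Real.norm_of_nonneg (Finset.prod_nonneg fun _ _ =>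
        Real.sqrt_nonneg _)]
      refine mul_le_mul ?_ h4 (norm_nonneg _) (by positivity)
      have h5 : ∀ k ∈ Finset.univ, √((z k).1 * (z k).2) ≤ √(β * δ) := fun k _ =>
        Real.sqrt_le_sqrt (mul_le_mul (hz k).1.2 (hz k).2.2 (hγ.trans (hz k).2.1).le hβ0.le)
      refine (Finset.prod_le_prod (fun _ _ => Real.sqrt_nonneg _) h5).trans (le_of_eq ?_)
      rw [Finset.prod_const, Finset.card_univ, Fintype.card_fin,
        show (4 : ℕ) = 2 * 2 from rfl, pow_mul, Real.sq_sqrt (by positivity)]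
  rw [hint, Complex.norm_real,
    Real.norm_of_nonneg (integral_nonneg fun _ => by positivity)] at hmain
  have k1 : ∫ x, pairSum (a * γ) x ∂(Measure.pi fun _ => volume.restrict (Set.Ioc α β)) ≤
      24 * (2 / (a * γ) * (β - α)) ^ 2 := integral_pairSum_le (by positivity) hαβ
  have k2 : ∫ y, pairSum (a * α) y ∂(Measure.pi fun _ => volume.restrict (Set.Ioc γ δ)) ≤
      24 * (2 / (a * α) * (δ - γ)) ^ 2 := integral_pairSum_le (by positivity) hγδ
  calc _ ≤ _ := hmain
    _ ≤ (2 * α * (2 * γ)) ^ 2 * ((24 * (2 / (a * γ) * (β - α)) ^ 2) *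
          (24 * (2 / (a * α) * (δ - γ)) ^ 2)) := by
        have k0 : (β * δ) ^ 2 ≤ (2 * α * (2 * γ)) ^ 2 := by gcongr
        exact mul_le_mul k0 (mul_le_mul k1 k2 (integral_nonneg (pairSum_nonneg _)) (by positivity))
          (mul_nonneg (integral_nonneg (pairSum_nonneg _)) (integral_nonneg (pairSum_nonneg _)))
          (by positivity)
    _ = _ := by field_simp; ring

/-! ### Box integrals: regularity and additivity -/

section BoxIntegral

variable {Ω : Type*} {L : ℝ≥0 → ℝ≥0 → Ω → ℝ} {θ : ℝ}

lemma norm_inner_integral_le {α β y B : ℝ} (hα : |α| ≤ B) (hβ : |β| ≤ B) (hy : |y| ≤ B) (ω : Ω) :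
    ‖∫ x in α..β, weightedPhase L θ x y ω‖ ≤ B * |β - α| := by
  refine intervalIntegral.norm_integral_le_of_norm_le_const fun x hx => ?_
  refine norm_weightedPhase_le (abs_le.2 ⟨?_, ?_⟩) hy ω
  · exact (le_min (abs_le.1 hα).1 (abs_le.1 hβ).1).trans hx.1.le
  · exact hx.2.trans (max_le (abs_le.1 hα).2 (abs_le.1 hβ).2)

lemma norm_boxIntegral_le {α β γ δ B : ℝ} (hα : |α| ≤ B) (hβ : |β| ≤ B) (hγ : |γ| ≤ B)
    (hδ : |δ| ≤ B) (ω : Ω) :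
    ‖boxIntegral L θ α β γ δ ω‖ ≤ B * |β - α| * |δ - γ| := by
  refine intervalIntegral.norm_integral_le_of_norm_le_const fun y hy => ?_
  refine norm_inner_integral_le hα hβ (abs_le.2 ⟨?_, ?_⟩) ω
  · exact (le_min (abs_le.1 hγ).1 (abs_le.1 hδ).1).trans hy.1.le
  · exact hy.2.trans (max_le (abs_le.1 hγ).2 (abs_le.1 hδ).2)

lemma intervalIntegrable_of_norm_le {f : ℝ → ℂ} (hf : Measurable f) {a b C : ℝ}
    (h : ∀ x, |x| ≤ max |a| |b| → ‖f x‖ ≤ C) : IntervalIntegrable f volume a b := by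
  rw [intervalIntegrable_iff]
  have : IsFiniteMeasure (volume.restrict (Set.uIoc a b)) := by rw [Set.uIoc]; infer_instance
  refine Integrable.of_bound (C := C) hf.aestronglyMeasurable ?_
  filter_upwards [ae_restrict_mem measurableSet_uIoc] with x hx
  refine h x (abs_le.2 ⟨?_, ?_⟩)
  · refine le_trans (le_min ?_ ?_) hx.1.le
    · exact (neg_le_neg (le_max_left _ _)).trans (neg_abs_le a)
    · exact (neg_le_neg (le_max_right _ _)).trans (neg_abs_le b)
  · exact hx.2.trans (max_le_max (le_abs_self a) (le_abs_self b))

variable [MeasurableSpace Ω] {P : Measure Ω}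

lemma intervalIntegrable_weightedPhase
    (hL : Measurable fun p : (ℝ≥0 × ℝ≥0) × Ω => L p.1.1 p.1.2 p.2)
    (a b y : ℝ) (ω : Ω) :
    IntervalIntegrable (fun x => weightedPhase L θ x y ω) volume a b := by
  refine intervalIntegrable_of_norm_le (C := max (max |a| |b|) |y|) ?_ fun x hx =>
    norm_weightedPhase_le (hx.trans (le_max_left _ _)) (le_max_right _ _) ω
  exact (measurable_weightedPhase hL).comp (by fun_prop : Measurable fun x : ℝ => ((x, y), ω))

lemma intervalIntegrable_inner_integral
    (hL : Measurable fun p : (ℝ≥0 × ℝ≥0) × Ω => L p.1.1 p.1.2 p.2)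
    (α β a b : ℝ) (ω : Ω) :
    IntervalIntegrable (fun y => ∫ x in α..β, weightedPhase L θ x y ω) volume a b := by
  have hm : StronglyMeasurable fun p : ℝ × ℝ => weightedPhase L θ p.2 p.1 ω :=
    ((measurable_weightedPhase hL).comp
      (by fun_prop : Measurable fun p : ℝ × ℝ => ((p.2, p.1), ω))).stronglyMeasurable
  set B := max (max |a| |b|) (max |α| |β|)
  refine intervalIntegrable_of_norm_le (C := B * |β - α|) ?_ fun y hy =>
    norm_inner_integral_le ((le_max_left _ _).trans (le_max_right _ _))
      ((le_max_right _ _).trans (le_max_right _ _)) (hy.trans (le_max_left _ _)) ω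
  exact (hm.integral_prod_right.sub hm.integral_prod_right).measurable

lemma boxIntegral_add_left
    (hL : Measurable fun p : (ℝ≥0 × ℝ≥0) × Ω => L p.1.1 p.1.2 p.2)
    (α m β γ δ : ℝ) (ω : Ω) :
    boxIntegral L θ α m γ δ ω + boxIntegral L θ m β γ δ ω = boxIntegral L θ α β γ δ ω := by
  unfold boxIntegral
  rw [← intervalIntegral.integral_add (intervalIntegrable_inner_integral hL _ _ _ _ _)
    (intervalIntegrable_inner_integral hL _ _ _ _ _)]
  refine intervalIntegral.integral_congr fun y _ => ?_
  exact intervalIntegral.integral_add_adjacent_intervals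
    (intervalIntegrable_weightedPhase hL _ _ _ _) (intervalIntegrable_weightedPhase hL _ _ _ _)

lemma boxIntegral_add_right
    (hL : Measurable fun p : (ℝ≥0 × ℝ≥0) × Ω => L p.1.1 p.1.2 p.2)
    (α β γ m δ : ℝ) (ω : Ω) :
    boxIntegral L θ α β γ m ω + boxIntegral L θ α β m δ ω = boxIntegral L θ α β γ δ ω :=
  intervalIntegral.integral_add_adjacent_intervals (intervalIntegrable_inner_integral hL _ _ _ _ _)
    (intervalIntegrable_inner_integral hL _ _ _ _ _)

lemma increment_boxIntegral
    (hL : Measurable fun p : (ℝ≥0 × ℝ≥0) × Ω => L p.1.1 p.1.2 p.2)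
    (s t s' t' : ℝ) (ω : Ω) :
    increment (fun u v => boxIntegral L θ 0 u 0 v ω) s t s' t' = boxIntegral L θ s s' t t' ω := by
  have h1 := boxIntegral_add_left (θ := θ) hL 0 s s' 0 t' ω
  have h2 := boxIntegral_add_left (θ := θ) hL 0 s s' 0 t ω
  have h3 := boxIntegral_add_right (θ := θ) hL s s' 0 t t' ω
  simp only [increment]
  linear_combination h2 - h1 - h3

lemma measurable_boxIntegral
    (hL : Measurable fun p : (ℝ≥0 × ℝ≥0) × Ω => L p.1.1 p.1.2 p.2)
    {α β γ δ : ℝ} (hαβ : α ≤ β) (hγδ : γ ≤ δ) :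
    Measurable (boxIntegral L θ α β γ δ) := by
  rw [funext fun ω => boxIntegral_eq_integral (θ := θ) hL hαβ hγδ ω]
  have hm : StronglyMeasurable fun p : Ω × (ℝ × ℝ) => weightedPhase L θ p.2.1 p.2.2 p.1 :=
    ((measurable_weightedPhase hL).comp
      (by fun_prop : Measurable fun p : Ω × (ℝ × ℝ) => (p.2, p.1))).stronglyMeasurable
  exact hm.integral_prod_right.measurable

lemma memLp_boxIntegral [IsProbabilityMeasure P]
    (hL : Measurable fun p : (ℝ≥0 × ℝ≥0) × Ω => L p.1.1 p.1.2 p.2)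
    {α β γ δ : ℝ} (hαβ : α ≤ β) (hγδ : γ ≤ δ)
    (p : ℝ≥0∞) : MemLp (boxIntegral L θ α β γ δ) p P := by
  set B := max (max |α| |β|) (max |γ| |δ|)
  refine MemLp.of_bound (measurable_boxIntegral hL hαβ hγδ).aestronglyMeasurable
    (B * |β - α| * |δ - γ|) (.of_forall fun ω => norm_boxIntegral_le ?_ ?_ ?_ ?_ ω)
  · exact (le_max_left _ _).trans (le_max_left _ _)
  · exact (le_max_right _ _).trans (le_max_left _ _)
  · exact (le_max_left _ _).trans (le_max_right _ _)
  · exact (le_max_right _ _).trans (le_max_right _ _)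

lemma continuous_boxIntegral
    (hL : Measurable fun p : (ℝ≥0 × ℝ≥0) × Ω => L p.1.1 p.1.2 p.2)
    (ω : Ω) :
    Continuous fun p : ℝ × ℝ => boxIntegral L θ 0 p.1 0 p.2 ω := by
  rw [continuous_iff_continuousAt]
  intro p
  set B := max |p.1| |p.2| + 1
  have hB : 0 ≤ B := by positivity
  have hbound : ∀ᶠ q in 𝓝 p, ‖boxIntegral L θ 0 q.1 0 q.2 ω - boxIntegral L θ 0 p.1 0 p.2 ω‖ ≤
      B * |q.1 - p.1| * |q.2| + B * |p.1| * |q.2 - p.2| := by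
    have h1 : ∀ᶠ q in 𝓝 p, |(q : ℝ × ℝ).1| < B :=
      (continuous_abs.comp continuous_fst).continuousAt.eventually_lt_const
        (by simp only [B]; linarith [le_max_left |p.1| |p.2|] : |p.1| < B)
    have h2 : ∀ᶠ q in 𝓝 p, |(q : ℝ × ℝ).2| < B :=
      (continuous_abs.comp continuous_snd).continuousAt.eventually_lt_const
        (by simp only [B]; linarith [le_max_right |p.1| |p.2|] : |p.2| < B)
    have h3 := h1.self_of_nhds
    have h4 := h2.self_of_nhds
    filter_upwards [h1, h2] with q hq1 hq2
    have e1 := boxIntegral_add_left (θ := θ) hL 0 p.1 q.1 0 q.2 ω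
    have e2 := boxIntegral_add_right (θ := θ) hL 0 p.1 0 p.2 q.2 ω
    have e3 : boxIntegral L θ 0 q.1 0 q.2 ω - boxIntegral L θ 0 p.1 0 p.2 ω =
        boxIntegral L θ p.1 q.1 0 q.2 ω + boxIntegral L θ 0 p.1 p.2 q.2 ω := by
      linear_combination -e1 - e2
    rw [e3]
    refine (norm_add_le _ _).trans (add_le_add ?_ ?_)
    · simpa using norm_boxIntegral_le (L := L) (θ := θ) h3.le hq1.le
        (by simpa using hB : |(0 : ℝ)| ≤ B) hq2.le ω
    · simpa using norm_boxIntegral_le (L := L) (θ := θ) (by simpa using hB : |(0 : ℝ)| ≤ B) h3.le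
        h4.le hq2.le ω
  rw [ContinuousAt, tendsto_iff_norm_sub_tendsto_zero]
  refine squeeze_zero' (.of_forall fun _ => norm_nonneg _) hbound ?_
  have hc : Continuous fun q : ℝ × ℝ => B * |q.1 - p.1| * |q.2| + B * |p.1| * |q.2 - p.2| := by
    fun_prop
  simpa using hc.tendsto p

end BoxIntegral

/-! ### Fourth moments over arbitrary boxes -/

/-- A subadditive interval function that is small in terms of the length on the intervals `[α, β]`
with `β ≤ 2 α` is so on all intervals of the half-line. An interval is halved repeatedly: its right
half is always of this kind, and the left halves shrink geometrically. -/
lemma le_sqrt_of_halving {φ : ℝ → ℝ → ℝ} {c R B : ℝ} (hc : 0 ≤ c)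
    (hsub : ∀ α m β, 0 ≤ α → α ≤ m → m ≤ β → β ≤ B → φ α β ≤ φ α m + φ m β)
    (hloc : ∀ α β, 0 < α → α ≤ β → β ≤ 2 * α → β ≤ B → φ α β ≤ c * √(β - α))
    (hcrude : ∀ α β, 0 ≤ α → α ≤ β → β ≤ B → φ α β ≤ R * (β - α)) {α β : ℝ} (hα : 0 ≤ α)
    (hαβ : α ≤ β) (hβ : β ≤ B) : φ α β ≤ 4 * c * √(β - α) := by
  have key : ∀ n : ℕ, ∀ β, α ≤ β → β ≤ B →
      φ α β ≤ 4 * c * √(β - α) + R * (β - α) * (1 / 2) ^ n := by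
    intro n
    induction n with
    | zero =>
      intro β h1 h2
      have := hcrude α β hα h1 h2
      have := mul_nonneg (mul_nonneg zero_le_four hc) (Real.sqrt_nonneg (β - α))
      rw [pow_zero]
      linarith
    | succ n ih =>
      intro β h1 h2
      rcases h1.eq_or_lt with rfl | h1
      · simpa using hcrude α α hα le_rfl h2
      set m := (α + β) / 2 with hm
      have a1 := ih m (by linarith) (by linarith)
      have a2 := hloc m β (by linarith) (by linarith) (by linarith) h2
      have a3 := hsub α m β hα (by linarith) (by linarith) h2
      rw [show m - α = (β - α) / 2 by rw [hm]; ring] at a1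
      rw [show β - m = (β - α) / 2 by rw [hm]; ring] at a2
      -- The estimate reproduces itself because `(4 + 1) / √2 ≤ 4`.
      have a4 : 5 * √((β - α) / 2) ≤ 4 * √(β - α) := by
        rw [show (5 : ℝ) = √25 by rw [show (25 : ℝ) = 5 ^ 2 by norm_num]; simp,
          show (4 : ℝ) = √16 by rw [show (16 : ℝ) = 4 ^ 2 by norm_num]; simp,
          ← Real.sqrt_mul (by norm_num), ← Real.sqrt_mul (by norm_num)]
        exact Real.sqrt_le_sqrt (by linarith)
      have a5 := mul_le_mul_of_nonneg_left a4 hc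
      rw [pow_succ]
      linarith
  have hlim : Filter.Tendsto (fun n : ℕ => 4 * c * √(β - α) + R * (β - α) * (1 / 2) ^ n)
      Filter.atTop (𝓝 (4 * c * √(β - α) + R * (β - α) * 0)) :=
    ((tendsto_pow_atTop_nhds_zero_of_lt_one (by norm_num) (by norm_num)).const_mul _).const_add _
  have := ge_of_tendsto' hlim fun n => key n β hαβ hβ
  simpa using this

lemma lpNorm_four_pow {Ω : Type*} [MeasurableSpace Ω] {P : Measure Ω} {f : Ω → ℂ}
    (hf : AEStronglyMeasurable f P) : lpNorm f 4 P ^ 4 = ∫ ω, ‖f ω‖ ^ 4 ∂P := by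
  rw [lpNorm_eq_integral_norm_rpow_toReal (by norm_num) (by norm_num) hf]
  have h4 : (4 : ℝ≥0∞).toReal = ((4 : ℕ) : ℝ) := by norm_num
  rw [h4]
  simp_rw [Real.rpow_natCast]
  rw [Real.rpow_inv_natCast_pow (integral_nonneg fun _ => by positivity) (by norm_num)]

/-- The fourth moment estimate for all boxes, with a constant that depends on `Re Ψ(θ)` only. -/
theorem IsLevySheet.lpNorm_boxIntegral_le {Ω : Type*} [MeasurableSpace Ω] {P : Measure Ω}
    {L : ℝ≥0 → ℝ≥0 → Ω → ℝ} {Ψ : ℝ → ℂ} {θ : ℝ} [IsProbabilityMeasure P]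
    (hLs : IsLevySheet L Ψ P) (hL : Measurable fun p : (ℝ≥0 × ℝ≥0) × Ω => L p.1.1 p.1.2 p.2)
    (ha : 0 < (Ψ θ).re) {α β γ δ : ℝ} (hα : 0 ≤ α) (hγ : 0 ≤ γ) (hαβ : α ≤ β) (hγδ : γ ≤ δ) :
    lpNorm (boxIntegral L θ α β γ δ) 4 P ≤
      4 * (4 * (√384 / (Ψ θ).re * √(δ - γ))) * √(β - α) := by
  set a := (Ψ θ).re
  have hcrude : ∀ {α β γ δ B : ℝ}, 0 ≤ α → α ≤ β → β ≤ B → 0 ≤ γ → γ ≤ δ → δ ≤ B →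
      lpNorm (boxIntegral L θ α β γ δ) 4 P ≤ B * (β - α) * (δ - γ) := by
    intro α β γ δ B h1 h2 h3 h4 h5 h6
    refine (lpNorm_mono_real (g := fun _ => B * (β - α) * (δ - γ)) (memLp_const _)
      fun ω => ?_).trans (le_of_eq ?_)
    · refine (norm_boxIntegral_le (B := B) ?_ ?_ ?_ ?_ ω).trans (le_of_eq ?_)
      · rw [abs_of_nonneg h1]; linarith
      · rw [abs_of_nonneg (h1.trans h2)]; linarith
      · rw [abs_of_nonneg h4]; linarith
      · rw [abs_of_nonneg (h4.trans h5)]; linarith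
      · rw [abs_of_nonneg (sub_nonneg.2 h2), abs_of_nonneg (sub_nonneg.2 h5)]
    · rw [lpNorm_const (by norm_num) (IsProbabilityMeasure.ne_zero P), probReal_univ,
        Real.one_rpow, mul_one, Real.norm_of_nonneg]
      have : 0 ≤ B := by linarith
      exact mul_nonneg (mul_nonneg this (sub_nonneg.2 h2)) (sub_nonneg.2 h5)
  have hloc : ∀ {α β γ δ : ℝ}, 0 < α → α ≤ β → β ≤ 2 * α → 0 < γ → γ ≤ δ → δ ≤ 2 * γ →
      lpNorm (boxIntegral L θ α β γ δ) 4 P ≤ √384 / a * √(β - α) * √(δ - γ) := by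
    intro α β γ δ h1 h2 h3 h4 h5 h6
    refine le_of_pow_le_pow_left₀ (n := 4) (by norm_num) (by positivity) ?_
    rw [lpNorm_four_pow (measurable_boxIntegral hL h2 h5).aestronglyMeasurable]
    refine (hLs.integral_norm_boxIntegral_pow_four_le hL ha h1 h4 h2 h5 h3 h6).trans (le_of_eq ?_)
    have e : ∀ x : ℝ, 0 ≤ x → √x ^ 4 = x ^ 2 := fun x hx => by
      rw [show (4 : ℕ) = 2 * 2 from rfl, pow_mul, Real.sq_sqrt hx]
    rw [mul_pow, mul_pow, div_pow, e _ (by norm_num), e _ (sub_nonneg.2 h2),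
      e _ (sub_nonneg.2 h5)]
  set B := max β δ
  -- Halving in the first variable, for a second side that is still away from the axis.
  have hx : ∀ {γ δ : ℝ}, 0 < γ → γ ≤ δ → δ ≤ 2 * γ → δ ≤ B → lpNorm (boxIntegral L θ α β γ δ) 4 P ≤
      4 * (√384 / a * √(β - α)) * √(δ - γ) := by
    intro γ δ h4 h5 h6 h7
    have := le_sqrt_of_halving (φ := fun α β => lpNorm (boxIntegral L θ α β γ δ) 4 P)
      (c := √384 / a * √(δ - γ)) (R := B * (δ - γ)) (B := B) (by positivity)
      (fun α m β _ h2 h3 _ => by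
        rw [← funext fun ω => boxIntegral_add_left (θ := θ) hL α m β γ δ ω]
        exact lpNorm_add_le (memLp_boxIntegral hL h2 h5 4) (by norm_num))
      (fun α β h1 h2 h3 _ => (hloc h1 h2 h3 h4 h5 h6).trans (le_of_eq (by ring)))
      (fun α β h1 h2 h3 => (hcrude h1 h2 h3 h4.le h5 h7).trans (le_of_eq (by ring)))
      hα hαβ (le_max_left _ _)
    exact this.trans (le_of_eq (by ring))
  -- Halving in the second variable.
  have := le_sqrt_of_halving (φ := fun γ δ => lpNorm (boxIntegral L θ α β γ δ) 4 P)
    (c := 4 * (√384 / a * √(β - α))) (R := B * (β - α)) (B := B) (by positivity)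
    (fun γ m δ _ h2 h3 _ => by
      rw [← funext fun ω => boxIntegral_add_right (θ := θ) hL α β γ m δ ω]
      exact lpNorm_add_le (memLp_boxIntegral hL hαβ h2 4) (by norm_num))
    (fun γ δ h1 h2 h3 h4 => hx h1 h2 h3 h4)
    (fun γ δ h1 h2 h3 => hcrude hα hαβ (le_max_left _ _) h1 h2 h3)
    hγ hγδ (le_max_right _ _)
  exact this.trans (le_of_eq (by ring))

/-! ### Dyadic chaining -/

/-- The modulus of continuity of a function on `[0, 1]` from its increments over dyadic intervals.
A point `x` is approximated by the dyadic points `⌊2ʲ x⌋ / 2ʲ`. -/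
theorem norm_sub_le_of_dyadic {g : ℝ → ℂ} (hg : ContinuousOn g (Set.Icc 0 1)) {ρ M : ℝ}
    (hρ0 : 0 ≤ ρ) (hρ1 : ρ < 1) (hM : 0 ≤ M)
    (h : ∀ j p : ℕ, p < 2 ^ j → ‖g ((p + 1 : ℕ) / 2 ^ j) - g (p / 2 ^ j)‖ ≤ M * ρ ^ j)
    (k : ℕ) {s t : ℝ} (hs : s ∈ Set.Icc (0 : ℝ) 1) (ht : t ∈ Set.Icc (0 : ℝ) 1)
    (hst : |s - t| ≤ (1 / 2) ^ k) : ‖g s - g t‖ ≤ 3 / (1 - ρ) * M * ρ ^ k := by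
  have hρ : 0 < 1 - ρ := by linarith
  let d : ℕ → ℝ → ℝ := fun j x => (⌊x * 2 ^ j⌋₊ : ℝ) / 2 ^ j
  have hfloor_le : ∀ x ∈ Set.Icc (0 : ℝ) 1, ∀ j : ℕ, ⌊x * 2 ^ j⌋₊ ≤ 2 ^ j := by
    intro x hx j
    refine Nat.floor_le_of_le ?_
    push_cast
    exact mul_le_of_le_one_left (by positivity) hx.2
  have hd_mem : ∀ x ∈ Set.Icc (0 : ℝ) 1, ∀ j, d j x ∈ Set.Icc (0 : ℝ) 1 := by
    intro x hx j
    refine ⟨by positivity, (div_le_one (by positivity)).2 ?_⟩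
    exact_mod_cast hfloor_le x hx j
  have hstep : ∀ x ∈ Set.Icc (0 : ℝ) 1, ∀ j, ‖g (d (j + 1) x) - g (d j x)‖ ≤ M * ρ ^ (j + 1) := by
    intro x hx j
    have h0 : 0 ≤ x * 2 ^ j := mul_nonneg hx.1 (by positivity)
    have h1 : 2 * ⌊x * 2 ^ j⌋₊ ≤ ⌊x * 2 ^ (j + 1)⌋₊ := by
      refine Nat.le_floor ?_
      push_cast
      have := Nat.floor_le h0
      rw [pow_succ]
      linarith
    have h2 : ⌊x * 2 ^ (j + 1)⌋₊ < 2 * ⌊x * 2 ^ j⌋₊ + 2 := by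
      refine (Nat.floor_lt (mul_nonneg hx.1 (by positivity))).2 ?_
      push_cast
      have := Nat.lt_floor_add_one (x * 2 ^ j)
      rw [pow_succ]
      linarith
    have h3 : d j x = ((2 * ⌊x * 2 ^ j⌋₊ : ℕ) : ℝ) / 2 ^ (j + 1) := by
      simp only [d]
      push_cast
      rw [pow_succ]
      field_simp
    rw [h3]
    obtain h4 | h4 : ⌊x * 2 ^ (j + 1)⌋₊ = 2 * ⌊x * 2 ^ j⌋₊ ∨
        ⌊x * 2 ^ (j + 1)⌋₊ = 2 * ⌊x * 2 ^ j⌋₊ + 1 := by omega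
    · simp only [d, h4, sub_self, norm_zero]
      positivity
    · have h5 := hfloor_le x hx (j + 1)
      simp only [d, h4]
      exact h (j + 1) _ (by omega)
  -- The telescoping sum over the levels is dominated by a geometric series.
  have hchain : ∀ x ∈ Set.Icc (0 : ℝ) 1, ∀ j n,
      ‖g (d (j + n) x) - g (d j x)‖ ≤ M * (ρ ^ j - ρ ^ (j + n)) / (1 - ρ) := by
    intro x hx j n
    induction n with
    | zero => simp
    | succ n ih =>
      have h1 := hstep x hx (j + n)
      have h2 : ρ ^ (j + n + 1) ≤ ρ ^ (j + n) := pow_le_pow_of_le_one hρ0 hρ1.le (Nat.le_succ _)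
      have h3 : ‖g (d (j + (n + 1)) x) - g (d j x)‖ ≤
          ‖g (d (j + n + 1) x) - g (d (j + n) x)‖ + ‖g (d (j + n) x) - g (d j x)‖ :=
        norm_sub_le_norm_sub_add_norm_sub _ _ _
      have h4 : M * (ρ ^ j - ρ ^ (j + n)) / (1 - ρ) + M * ρ ^ (j + n) =
          M * (ρ ^ j - ρ ^ (j + (n + 1))) / (1 - ρ) := by
        rw [← add_assoc j n 1, pow_succ ρ (j + n)]
        field_simp
        ring
      rw [← h4]
      have h5 := mul_le_mul_of_nonneg_left h2 hM
      linarith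
  have hlim : ∀ x ∈ Set.Icc (0 : ℝ) 1, Filter.Tendsto (fun n => d n x) Filter.atTop (𝓝 x) := by
    intro x hx
    have h1 : Filter.Tendsto (fun n : ℕ => x - (1 / 2 : ℝ) ^ n) Filter.atTop (𝓝 (x - 0)) :=
      (tendsto_pow_atTop_nhds_zero_of_lt_one (by norm_num) (by norm_num)).const_sub _
    rw [sub_zero] at h1
    refine tendsto_of_tendsto_of_tendsto_of_le_of_le h1 tendsto_const_nhds (fun n => ?_) fun n => ?_
    · have := Nat.lt_floor_add_one (x * 2 ^ n)
      simp only [d, one_div, inv_pow]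
      rw [le_div_iff₀ (by positivity), sub_mul, inv_mul_cancel₀ (by positivity)]
      linarith
    · exact (div_le_iff₀ (by positivity)).2 (Nat.floor_le (mul_nonneg hx.1 (by positivity)))
  have happrox : ∀ x ∈ Set.Icc (0 : ℝ) 1, ∀ j, ‖g x - g (d j x)‖ ≤ M * ρ ^ j / (1 - ρ) := by
    intro x hx j
    have h1 : Filter.Tendsto (fun n => d (j + n) x) Filter.atTop (𝓝[Set.Icc 0 1] x) :=
      tendsto_nhdsWithin_iff.2 ⟨(hlim x hx).comp (Filter.tendsto_add_atTop_nat j |>.congr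
        fun n => Nat.add_comm n j), .of_forall fun n => hd_mem x hx _⟩
    have h2 := (((hg x hx).tendsto.comp h1).sub_const (g (d j x))).norm
    refine le_of_tendsto h2 (.of_forall fun n => (hchain x hx j n).trans ?_)
    have := pow_nonneg hρ0 (j + n)
    gcongr
    linarith
  -- The dyadic approximations of two points at distance at most `2⁻ᵏ` agree or are neighbours.
  have hnear : ∀ x ∈ Set.Icc (0 : ℝ) 1, ∀ y ∈ Set.Icc (0 : ℝ) 1, x ≤ y → y - x ≤ (1 / 2) ^ k →
      ‖g (d k y) - g (d k x)‖ ≤ M * ρ ^ k := by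
    intro x hx y hy hxy hyx
    have h1 : ⌊x * 2 ^ k⌋₊ ≤ ⌊y * 2 ^ k⌋₊ := Nat.floor_mono (by gcongr)
    have h2 : ⌊y * 2 ^ k⌋₊ ≤ ⌊x * 2 ^ k⌋₊ + 1 := by
      rw [← Nat.floor_add_one (mul_nonneg hx.1 (by positivity))]
      refine Nat.floor_mono ?_
      have h3 := mul_le_mul_of_nonneg_right hyx (by positivity : (0 : ℝ) ≤ 2 ^ k)
      rw [← mul_pow] at h3
      norm_num at h3
      linarith
    obtain h4 | h4 : ⌊y * 2 ^ k⌋₊ = ⌊x * 2 ^ k⌋₊ ∨ ⌊y * 2 ^ k⌋₊ = ⌊x * 2 ^ k⌋₊ + 1 := by omega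
    · simp only [d, h4, sub_self, norm_zero]
      positivity
    · have h5 := hfloor_le y hy k
      simp only [d, h4]
      exact h k _ (by omega)
  have hordered : ∀ x ∈ Set.Icc (0 : ℝ) 1, ∀ y ∈ Set.Icc (0 : ℝ) 1, x ≤ y → y - x ≤ (1 / 2) ^ k →
      ‖g y - g x‖ ≤ 3 / (1 - ρ) * M * ρ ^ k := by
    intro x hx y hy hxy hyx
    have h1 := happrox x hx k
    have h2 := happrox y hy k
    have h3 := hnear x hx y hy hxy hyx
    have h4 : ‖g y - g x‖ ≤ ‖g y - g (d k y)‖ + ‖g (d k y) - g (d k x)‖ + ‖g x - g (d k x)‖ := by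
      rw [norm_sub_rev (g x)]
      refine le_trans (le_of_eq ?_) (norm_add₃_le)
      congr 1
      ring
    have h5 : M * ρ ^ k ≤ M * ρ ^ k / (1 - ρ) :=
      le_div_self (by positivity) hρ (by linarith)
    have h6 : 3 / (1 - ρ) * M * ρ ^ k = 3 * (M * ρ ^ k / (1 - ρ)) := by ring
    linarith
  rcases le_total s t with hle | hle
  · rw [norm_sub_rev]
    exact hordered s hs t ht hle (by rwa [abs_sub_comm, abs_of_nonneg (sub_nonneg.2 hle)] at hst)
  · exact hordered t ht s hs hle (by rwa [abs_of_nonneg (sub_nonneg.2 hle)] at hst)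

lemma increment_eq_sub_sub {f : ℝ → ℝ → ℂ} (s t s' t' : ℝ) :
    increment f s t s' t' = (f s' t' - f s t') - (f s' t - f s t) := by
  simp only [increment]; ring

/-- The two-parameter version: the one-parameter estimate is applied to the increments of `f` in
one variable, first over dyadic and then over arbitrary intervals of the other variable. -/
theorem norm_increment_le_of_dyadic {f : ℝ → ℝ → ℂ} (hf : Continuous fun p : ℝ × ℝ => f p.1 p.2)
    {ρ M : ℝ} (hρ0 : 0 ≤ ρ) (hρ1 : ρ < 1) (hM : 0 ≤ M)
    (h : ∀ j k p q : ℕ, p < 2 ^ j → q < 2 ^ k →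
      ‖increment f (p / 2 ^ j) (q / 2 ^ k) ((p + 1 : ℕ) / 2 ^ j) ((q + 1 : ℕ) / 2 ^ k)‖ ≤
        M * (ρ ^ j * ρ ^ k))
    (j k : ℕ) {s s' t t' : ℝ} (hs : s ∈ Set.Icc (0 : ℝ) 1) (hs' : s' ∈ Set.Icc (0 : ℝ) 1)
    (ht : t ∈ Set.Icc (0 : ℝ) 1) (ht' : t' ∈ Set.Icc (0 : ℝ) 1) (hss : |s' - s| ≤ (1 / 2) ^ j)
    (htt : |t' - t| ≤ (1 / 2) ^ k) :
    ‖increment f s t s' t'‖ ≤ (3 / (1 - ρ)) ^ 2 * M * (ρ ^ j * ρ ^ k) := by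
  have hρ : 0 < 1 - ρ := by linarith
  have hc1 : ∀ a, Continuous fun t => f a t := fun a =>
    hf.comp (by fun_prop : Continuous fun t : ℝ => (a, t))
  have hc2 : ∀ b, Continuous fun s => f s b := fun b =>
    hf.comp (by fun_prop : Continuous fun s : ℝ => (s, b))
  have h1 : ∀ i p : ℕ, p < 2 ^ i →
      ‖(f ((p + 1 : ℕ) / 2 ^ i) t' - f ((p + 1 : ℕ) / 2 ^ i) t) -
        (f (p / 2 ^ i) t' - f (p / 2 ^ i) t)‖ ≤ 3 / (1 - ρ) * M * ρ ^ k * ρ ^ i := by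
    intro i p hp
    have := norm_sub_le_of_dyadic
      (g := fun b => f ((p + 1 : ℕ) / 2 ^ i) b - f (p / 2 ^ i) b) (M := M * ρ ^ i)
      ((hc1 _).sub (hc1 _)).continuousOn hρ0 hρ1 (by positivity)
      (fun k q hq => by
        refine le_trans (le_of_eq ?_) ((h i k p q hp hq).trans (le_of_eq (by ring)))
        rw [increment_eq_sub_sub]) k ht' ht htt
    refine le_trans (le_of_eq ?_) (this.trans (le_of_eq (by ring)))
    congr 1
    ring
  have h2 := norm_sub_le_of_dyadic (g := fun a => f a t' - f a t) (M := 3 / (1 - ρ) * M * ρ ^ k)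
    ((hc2 _).sub (hc2 _)).continuousOn hρ0 hρ1 (by positivity) h1 j hs' hs hss
  refine le_trans (le_of_eq ?_) (h2.trans (le_of_eq (by ring)))
  congr 1
  simp only [increment]
  ring

/-! ### Tightness in the space of continuous functions of two variables -/

/-- The Borel `σ`-algebra of `C(K, ℂ)` is generated by the evaluations: closed balls are countable
intersections of conditions on the values at a dense sequence. -/
lemma measurable_of_measurable_eval {Ω K : Type*} [MeasurableSpace Ω] [TopologicalSpace K]
    [CompactSpace K] [TopologicalSpace.SeparableSpace K] [MeasurableSpace C(K, ℂ)]
    [BorelSpace C(K, ℂ)] [SecondCountableTopology C(K, ℂ)] {Y : Ω → C(K, ℂ)}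
    (hY : ∀ p, Measurable fun ω => Y ω p) : Measurable Y := by
  rcases isEmpty_or_nonempty K with hK | hK
  · have : Subsingleton C(K, ℂ) := ⟨fun f g => ContinuousMap.ext fun x => hK.elim x⟩
    exact measurable_of_subsingleton_codomain Y
  have hball : ∀ (f : C(K, ℂ)) (r : ℝ), MeasurableSet (Y ⁻¹' Metric.closedBall f r) := by
    intro f r
    have h1 : Y ⁻¹' Metric.closedBall f r =
        ⋂ n : ℕ, {ω | dist (Y ω (TopologicalSpace.denseSeq K n))
          (f (TopologicalSpace.denseSeq K n)) ≤ r} := by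
      ext ω
      simp only [Set.mem_preimage, Metric.mem_closedBall, Set.mem_iInter, Set.mem_ofPred_eq]
      rw [ContinuousMap.dist_le_iff_of_nonempty]
      refine ⟨fun h n => h _, fun h x => ?_⟩
      exact (TopologicalSpace.denseRange_denseSeq K).induction_on
        (p := fun x => dist (Y ω x) (f x) ≤ r) x
        (isClosed_le ((Y ω).continuous.dist f.continuous) continuous_const) h
    rw [h1]
    exact MeasurableSet.iInter fun n => measurableSet_le ((hY _).dist measurable_const)
      measurable_const
  refine measurable_of_isOpen fun U hU => ?_
  have hr : ∀ f : U, ∃ r > 0, Metric.closedBall (f : C(K, ℂ)) r ⊆ U := fun f =>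
    Metric.nhds_basis_closedBall.mem_iff.1 (hU.mem_nhds f.2)
  choose r hr0 hrU using hr
  obtain ⟨T, hT, hTU⟩ := TopologicalSpace.isOpen_iUnion_countable
    (fun f : U => Metric.ball (f : C(K, ℂ)) (r f)) fun f => Metric.isOpen_ball
  have h2 : Y ⁻¹' U = ⋃ f ∈ T, Y ⁻¹' Metric.closedBall (f : C(K, ℂ)) (r f) := by
    ext ω
    simp only [Set.mem_preimage, Set.mem_iUnion, exists_prop]
    constructor
    · intro h
      have h3 : Y ω ∈ ⋃ f : U, Metric.ball (f : C(K, ℂ)) (r f) :=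
        Set.mem_iUnion.2 ⟨⟨Y ω, h⟩, Metric.mem_ball_self (hr0 _)⟩
      rw [← hTU] at h3
      simp only [Set.mem_iUnion, exists_prop] at h3
      obtain ⟨f, hf, hfY⟩ := h3
      exact ⟨f, hf, Metric.ball_subset_closedBall hfY⟩
    · rintro ⟨f, _, hfY⟩
      exact hrU f hfY
  rw [h2]
  exact MeasurableSet.biUnion hT fun f _ => hball _ _

/-- The functions on `[0, S] × [0, T]` that vanish at the origin and have a prescribed modulus of
continuity `M ρʲ` at the scales `(S 2⁻ʲ, T 2⁻ʲ)`. -/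
def modulusSet (S T ρ M : ℝ) : Set (PathSpace S T) :=
  {f | (∀ p : Set.Icc (0 : ℝ) S × Set.Icc (0 : ℝ) T, (p.1 : ℝ) = 0 → (p.2 : ℝ) = 0 → f p = 0) ∧
    ∀ (j : ℕ) (p q : Set.Icc (0 : ℝ) S × Set.Icc (0 : ℝ) T),
      |(p.1 : ℝ) - q.1| ≤ S * (1 / 2) ^ j → |(p.2 : ℝ) - q.2| ≤ T * (1 / 2) ^ j →
        ‖f p - f q‖ ≤ M * ρ ^ j}

lemma isClosed_modulusSet (S T ρ M : ℝ) : IsClosed (modulusSet S T ρ M) := by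
  simp only [modulusSet, Set.ofPred_and, Set.ofPred_forall]
  refine IsClosed.inter ?_ ?_
  · refine isClosed_iInter fun p => isClosed_iInter fun _ => isClosed_iInter fun _ => ?_
    exact isClosed_eq (continuous_eval_const p) continuous_const
  · refine isClosed_iInter fun j => isClosed_iInter fun p => isClosed_iInter fun q =>
      isClosed_iInter fun _ => isClosed_iInter fun _ => ?_
    exact isClosed_le ((continuous_eval_const p).sub
      (continuous_eval_const q)).norm continuous_const

/-- Arzelà–Ascoli. -/
lemma isCompact_modulusSet {S T ρ M : ℝ} (hS : 0 < S) (hT : 0 < T) (hρ0 : 0 ≤ ρ) (hρ1 : ρ < 1) :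
    IsCompact (modulusSet S T ρ M) := by
  let e := ContinuousMap.isometryEquivBoundedOfCompact
    (Set.Icc (0 : ℝ) S × Set.Icc (0 : ℝ) T) ℂ
  rw [← e.toHomeomorph.isCompact_image]
  refine BoundedContinuousFunction.arzela_ascoli₂ (Metric.closedBall 0 M)
    (isCompact_closedBall _ _) _ (e.toHomeomorph.isClosed_image.2 (isClosed_modulusSet S T ρ M)) ?_
    ?_
  · rintro _ p ⟨f, hf, rfl⟩
    have h0 : f (⟨0, le_rfl, hS.le⟩, ⟨0, le_rfl, hT.le⟩) = 0 := hf.1 _ rfl rfl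
    have h1 := hf.2 0 p (⟨0, le_rfl, hS.le⟩, ⟨0, le_rfl, hT.le⟩)
      (by simpa [abs_of_nonneg p.1.2.1] using p.1.2.2)
      (by simpa [abs_of_nonneg p.2.2.1] using p.2.2.2)
    rw [h0, sub_zero, pow_zero, mul_one] at h1
    exact mem_closedBall_zero_iff.2 h1
  · refine UniformEquicontinuous.equicontinuous (Metric.uniformEquicontinuous_iff.2 fun ε hε => ?_)
    have h1 : Filter.Tendsto (fun j : ℕ => M * ρ ^ j) Filter.atTop (𝓝 (M * 0)) :=
      (tendsto_pow_atTop_nhds_zero_of_lt_one hρ0 hρ1).const_mul M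
    rw [mul_zero] at h1
    obtain ⟨j, hj⟩ := (h1.eventually_lt_const hε).exists
    refine ⟨min S T * (1 / 2) ^ j, mul_pos (lt_min hS hT) (by positivity), fun p q hpq => ?_⟩
    rintro ⟨_, f, hf, rfl⟩
    have h2 : dist p.1 q.1 < min S T * (1 / 2) ^ j := (le_max_left _ _).trans_lt hpq
    have h3 : dist p.2 q.2 < min S T * (1 / 2) ^ j := (le_max_right _ _).trans_lt hpq
    refine lt_of_le_of_lt ?_ hj
    refine (dist_eq_norm _ _).le.trans (hf.2 j p q (h2.le.trans ?_) (h3.le.trans ?_))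
    · exact mul_le_mul_of_nonneg_right (min_le_left _ _) (by positivity)
    · exact mul_le_mul_of_nonneg_right (min_le_right _ _) (by positivity)

/-- The sum, over all dyadic cells of the unit square, of the fourth powers of the increments of
`f`, where the cells of size `2⁻ʲ × 2⁻ᵏ` have weight `ρ ^ (-4 (j + k))`. -/
noncomputable def dyadicSum (ρ : ℝ) (f : ℝ → ℝ → ℂ) : ℝ≥0∞ :=
  ∑' n : ℕ × ℕ, ∑ p ∈ Finset.range (2 ^ n.1), ∑ q ∈ Finset.range (2 ^ n.2),
    ‖increment f (p / 2 ^ n.1) (q / 2 ^ n.2) ((p + 1 : ℕ) / 2 ^ n.1) ((q + 1 : ℕ) / 2 ^ n.2)‖ₑ ^ 4 *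
      ENNReal.ofReal (((ρ ^ n.1 * ρ ^ n.2) ^ 4)⁻¹)

lemma norm_increment_le_of_dyadicSum_le {ρ M : ℝ} {f : ℝ → ℝ → ℂ} (hρ : 0 < ρ) (hM : 0 ≤ M)
    (h : dyadicSum ρ f ≤ ENNReal.ofReal (M ^ 4)) (j k p q : ℕ) (hp : p < 2 ^ j) (hq : q < 2 ^ k) :
    ‖increment f (p / 2 ^ j) (q / 2 ^ k) ((p + 1 : ℕ) / 2 ^ j) ((q + 1 : ℕ) / 2 ^ k)‖ ≤
      M * (ρ ^ j * ρ ^ k) := by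
  set z := increment f (p / 2 ^ j) (q / 2 ^ k) ((p + 1 : ℕ) / 2 ^ j) ((q + 1 : ℕ) / 2 ^ k)
    with hz
  have h1 : ‖z‖ₑ ^ 4 * ENNReal.ofReal (((ρ ^ j * ρ ^ k) ^ 4)⁻¹) ≤ ENNReal.ofReal (M ^ 4) := by
    refine le_trans ?_ h
    refine le_trans ?_ (ENNReal.le_tsum ((j, k) : ℕ × ℕ))
    refine le_trans ?_ (Finset.single_le_sum (fun _ _ => zero_le) (Finset.mem_range.2 hp))
    exact Finset.single_le_sum
      (f := fun q : ℕ => ‖increment f (p / 2 ^ j) (q / 2 ^ k) ((p + 1 : ℕ) / 2 ^ j)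
        ((q + 1 : ℕ) / 2 ^ k)‖ₑ ^ 4 * ENNReal.ofReal (((ρ ^ j * ρ ^ k) ^ 4)⁻¹))
      (fun _ _ => zero_le) (Finset.mem_range.2 hq)
  rw [← ofReal_norm, ← ENNReal.ofReal_pow (norm_nonneg _),
    ← ENNReal.ofReal_mul (by positivity), ENNReal.ofReal_le_ofReal_iff (by positivity),
    ← div_eq_mul_inv, div_le_iff₀ (by positivity), ← mul_pow] at h1
  exact le_of_pow_le_pow_left₀ (by norm_num) (by positivity) h1

lemma mem_modulusSet_of_dyadicSum_le {S T ρ M : ℝ} (hS : 0 < S) (hT : 0 < T) (hρ0 : 0 < ρ)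
    (hρ1 : ρ < 1) (hM : 0 ≤ M) {f : ℝ → ℝ → ℂ} (hf : Continuous fun p : ℝ × ℝ => f p.1 p.2)
    (hf1 : ∀ t, f 0 t = 0) (hf2 : ∀ s, f s 0 = 0)
    (h : dyadicSum ρ (fun u v => f (S * u) (T * v)) ≤ ENNReal.ofReal (M ^ 4))
    {y : PathSpace S T} (hy : ∀ p, y p = f p.1 p.2) :
    y ∈ modulusSet S T ρ (2 * ((3 / (1 - ρ)) ^ 2 * M)) := by
  refine ⟨fun p h1 _ => by rw [hy, h1, hf1], fun j p q h1 h2 => ?_⟩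
  set F : ℝ → ℝ → ℂ := fun u v => f (S * u) (T * v) with hF
  have hFc : Continuous fun p : ℝ × ℝ => F p.1 p.2 :=
    hf.comp (by fun_prop : Continuous fun p : ℝ × ℝ => (S * p.1, T * p.2))
  have key := norm_increment_le_of_dyadic hFc hρ0.le hρ1 hM
    (norm_increment_le_of_dyadicSum_le hρ0 hM h)
  have hmemS : ∀ x : Set.Icc (0 : ℝ) S, (x : ℝ) / S ∈ Set.Icc (0 : ℝ) 1 := fun x =>
    ⟨div_nonneg x.2.1 hS.le, (div_le_one hS).2 x.2.2⟩
  have hmemT : ∀ x : Set.Icc (0 : ℝ) T, (x : ℝ) / T ∈ Set.Icc (0 : ℝ) 1 := fun x =>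
    ⟨div_nonneg x.2.1 hT.le, (div_le_one hT).2 x.2.2⟩
  have h0 : (0 : ℝ) ∈ Set.Icc (0 : ℝ) 1 := ⟨le_rfl, zero_le_one⟩
  have e : ∀ r : Set.Icc (0 : ℝ) S × Set.Icc (0 : ℝ) T,
      y r = F ((r.1 : ℝ) / S) ((r.2 : ℝ) / T) := fun r => by
    rw [hy, hF]
    simp only [mul_div_cancel₀ _ hS.ne', mul_div_cancel₀ _ hT.ne']
  have hF1 : ∀ v, F 0 v = 0 := fun v => by simp [hF, hf1]
  have hF2 : ∀ u, F u 0 = 0 := fun u => by simp [hF, hf2]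
  have d1 : |(p.1 : ℝ) / S - q.1 / S| ≤ (1 / 2) ^ j := by
    rw [← sub_div, abs_div, abs_of_pos hS, div_le_iff₀ hS, mul_comm]
    exact h1
  have d2 : |(p.2 : ℝ) / T - q.2 / T| ≤ (1 / 2) ^ j := by
    rw [← sub_div, abs_div, abs_of_pos hT, div_le_iff₀ hT, mul_comm]
    exact h2
  have k1 := key j 0 (hmemS q.1) (hmemS p.1) h0 (hmemT p.2) d1
    (by rw [sub_zero, pow_zero, abs_of_nonneg (hmemT p.2).1]; exact (hmemT p.2).2)
  have k2 := key 0 j h0 (hmemS q.1) (hmemT q.2) (hmemT p.2)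
    (by rw [sub_zero, pow_zero, abs_of_nonneg (hmemS q.1).1]; exact (hmemS q.1).2) d2
  -- The field vanishes on the axes, so its values are increments over boxes that touch an axis.
  have e2 : y p - y q = increment F ((q.1 : ℝ) / S) 0 (p.1 / S) (p.2 / T) +
      increment F 0 ((q.2 : ℝ) / T) (q.1 / S) (p.2 / T) := by
    rw [e, e]
    simp only [increment, hF1, hF2]
    ring
  rw [e2]
  rw [pow_zero] at k1 k2
  refine (norm_add_le _ _).trans ?_
  linarith

/-- A level has `2ʲ⁺ᵏ` cells, each with a moment of order `4⁻ʲ⁻ᵏ`; hence the condition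
`2 ρ⁴ > 1`. -/
lemma exists_lintegral_dyadicSum_le {S T C ρ : ℝ} (hS : 0 < S) (hT : 0 < T) (hC : 0 ≤ C)
    (hρ0 : 0 < ρ) (hρ : 1 < 2 * ρ ^ 4) :
    ∃ D : ℝ, ∀ {Ω : Type*} [MeasurableSpace Ω] (P : Measure Ω) (X : ℝ → ℝ → Ω → ℂ),
      (∀ s t, 0 ≤ s → 0 ≤ t → Measurable (X s t)) →
      (∀ s t s' t' : ℝ, 0 ≤ s → s < s' → s' ≤ S → 0 ≤ t → t < t' → t' ≤ T →
        ∫⁻ ω, ‖increment (fun u v => X u v ω) s t s' t'‖ₑ ^ 4 ∂P ≤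
          ENNReal.ofReal (C * (s' - s) ^ 2 * (t' - t) ^ 2)) →
      Measurable (fun ω => dyadicSum ρ fun u v => X (S * u) (T * v) ω) ∧
      ∫⁻ ω, dyadicSum ρ (fun u v => X (S * u) (T * v) ω) ∂P ≤ ENNReal.ofReal D := by
  set r : ℝ := (2 * ρ ^ 4)⁻¹ with hr
  have hr0 : 0 ≤ r := by positivity
  have hr1 : r < 1 := inv_lt_one_of_one_lt₀ hρ
  have hsum : Summable fun n : ℕ × ℕ => C * S ^ 2 * T ^ 2 * (r ^ n.1 * r ^ n.2) :=
    ((summable_geometric_of_lt_one hr0 hr1).mul_of_nonneg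
      (summable_geometric_of_lt_one hr0 hr1)
      (fun _ => by positivity) (fun _ => by positivity)).mul_left _
  refine ⟨∑' n : ℕ × ℕ, C * S ^ 2 * T ^ 2 * (r ^ n.1 * r ^ n.2), ?_⟩
  intro Ω _ P X hm hX
  have hmi : ∀ (n : ℕ × ℕ) (p q : ℕ), Measurable fun ω =>
      ‖increment (fun u v => X (S * u) (T * v) ω) (p / 2 ^ n.1) (q / 2 ^ n.2)
        ((p + 1 : ℕ) / 2 ^ n.1) ((q + 1 : ℕ) / 2 ^ n.2)‖ₑ ^ 4 := by
    intro n p q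
    have a : ∀ p q : ℕ, Measurable (X (S * (p / 2 ^ n.1)) (T * (q / 2 ^ n.2))) := fun p q =>
      hm _ _ (by positivity) (by positivity)
    exact ((((a _ _).sub (a _ _)).sub (a _ _)).add (a _ _)).enorm.pow_const 4
  have hmn : ∀ n : ℕ × ℕ, Measurable fun ω =>
      ∑ p ∈ Finset.range (2 ^ n.1), ∑ q ∈ Finset.range (2 ^ n.2),
        ‖increment (fun u v => X (S * u) (T * v) ω) (p / 2 ^ n.1) (q / 2 ^ n.2)
          ((p + 1 : ℕ) / 2 ^ n.1) ((q + 1 : ℕ) / 2 ^ n.2)‖ₑ ^ 4 *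
            ENNReal.ofReal (((ρ ^ n.1 * ρ ^ n.2) ^ 4)⁻¹) := fun n =>
    Finset.measurable_fun_sum _ fun p _ => Finset.measurable_fun_sum _ fun q _ =>
      (hmi n p q).mul_const _
  refine ⟨Measurable.tsum hmn, ?_⟩
  unfold dyadicSum
  rw [lintegral_tsum fun n => (hmn n).aemeasurable,
    ENNReal.ofReal_tsum_of_nonneg (fun n => by positivity) hsum]
  refine ENNReal.tsum_le_tsum fun n => ?_
  rw [lintegral_finsetSum _ fun p _ => Finset.measurable_fun_sum _ fun q _ =>
    (hmi n p q).mul_const _]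
  have hcell : ∀ p ∈ Finset.range (2 ^ n.1), ∀ q ∈ Finset.range (2 ^ n.2),
      ∫⁻ ω, ‖increment (fun u v => X (S * u) (T * v) ω) (p / 2 ^ n.1) (q / 2 ^ n.2)
          ((p + 1 : ℕ) / 2 ^ n.1) ((q + 1 : ℕ) / 2 ^ n.2)‖ₑ ^ 4 *
            ENNReal.ofReal (((ρ ^ n.1 * ρ ^ n.2) ^ 4)⁻¹) ∂P ≤
        ENNReal.ofReal (C * S ^ 2 * T ^ 2 * ((r / 2) ^ n.1 * (r / 2) ^ n.2)) := by
    intro p hp q hq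
    rw [lintegral_mul_const _ (hmi n p q)]
    have hp' : ((p + 1 : ℕ) : ℝ) ≤ 2 ^ n.1 := by exact_mod_cast Finset.mem_range.1 hp
    have hq' : ((q + 1 : ℕ) : ℝ) ≤ 2 ^ n.2 := by exact_mod_cast Finset.mem_range.1 hq
    have h1 := hX (S * (p / 2 ^ n.1)) (T * (q / 2 ^ n.2)) (S * ((p + 1 : ℕ) / 2 ^ n.1))
      (T * ((q + 1 : ℕ) / 2 ^ n.2)) (by positivity) (by gcongr; simp)
      (mul_le_of_le_one_right hS.le ((div_le_one (by positivity)).2 hp')) (by positivity)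
      (by gcongr; simp) (mul_le_of_le_one_right hT.le ((div_le_one (by positivity)).2 hq'))
    refine (mul_le_mul_left h1 _).trans ?_
    rw [← ENNReal.ofReal_mul (by positivity)]
    refine ENNReal.ofReal_le_ofReal (le_of_eq ?_)
    -- Here `r / 2 = 4⁻¹ ρ⁻⁴`: the squared side length times the weight.
    have e1 : ∀ k : ℕ, (r / 2) ^ k = (((2 : ℝ) ^ k)⁻¹) ^ 2 * ((ρ ^ k) ^ 4)⁻¹ := by
      intro k
      rw [hr, div_pow, inv_pow, mul_pow, ← pow_mul ρ 4, mul_comm 4 k, pow_mul ρ k]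
      field_simp
    rw [e1, e1]
    push_cast
    rw [mul_pow _ _ 4, mul_inv]
    ring
  refine (Finset.sum_le_sum (g := fun _ => ((2 ^ n.2 : ℕ) : ℝ≥0∞) * ENNReal.ofReal
    (C * S ^ 2 * T ^ 2 * ((r / 2) ^ n.1 * (r / 2) ^ n.2))) fun p hp => ?_).trans ?_
  · rw [lintegral_finsetSum _ fun q _ => (hmi n p q).mul_const _]
    refine (Finset.sum_le_sum fun q hq => hcell p hp q hq).trans (le_of_eq ?_)
    rw [Finset.sum_const, Finset.card_range, nsmul_eq_mul]
  · rw [Finset.sum_const, Finset.card_range, nsmul_eq_mul, ← ENNReal.ofReal_natCast,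
      ← ENNReal.ofReal_natCast, ← ENNReal.ofReal_mul (by positivity),
      ← ENNReal.ofReal_mul (by positivity)]
    refine ENNReal.ofReal_le_ofReal (le_of_eq ?_)
    push_cast
    rw [div_pow, div_pow]
    field_simp

/-- A tightness criterion of Chentsov type: random continuous fields on `[0, S] × [0, T]` that
vanish on the axes form a tight family if the fourth moments of their increments over rectangles are
bounded by the squared area. -/
theorem isTightMeasureSet_of_increment_moment {Ω ι : Type*} [MeasurableSpace Ω] (P : Measure Ω)
    {S T C : ℝ} (hS : 0 < S) (hT : 0 < T) (hC : 0 ≤ C) (X : ι → ℝ → ℝ → Ω → ℂ)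
    (hcont : ∀ i ω, Continuous fun p : ℝ × ℝ => X i p.1 p.2 ω)
    (hmeas : ∀ i s t, 0 ≤ s → 0 ≤ t → Measurable (X i s t))
    (hX1 : ∀ i t ω, X i 0 t ω = 0) (hX2 : ∀ i s ω, X i s 0 ω = 0)
    (hmom : ∀ i, ∀ s t s' t' : ℝ, 0 ≤ s → s < s' → s' ≤ S → 0 ≤ t → t < t' → t' ≤ T →
      ∫⁻ ω, ‖increment (fun u v => X i u v ω) s t s' t'‖ₑ ^ 4 ∂P ≤
        ENNReal.ofReal (C * (s' - s) ^ 2 * (t' - t) ^ 2))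
    (Y : ι → Ω → PathSpace S T) (hY : ∀ i ω p, Y i ω p = X i p.1 p.2 ω)
    (hYm : ∀ i, Measurable (Y i)) :
    IsTightMeasureSet (Set.range fun i => P.map (Y i)) := by
  obtain ⟨ρ, hρ0, hρ1, hρ⟩ : ∃ ρ : ℝ, 0 < ρ ∧ ρ < 1 ∧ 1 < 2 * ρ ^ 4 :=
    ⟨9 / 10, by norm_num, by norm_num, by norm_num⟩
  obtain ⟨D, hD⟩ := exists_lintegral_dyadicSum_le hS hT hC hρ0 hρ
  rw [isTightMeasureSet_iff_exists_isCompact_measure_compl_le]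
  intro η hη
  obtain ⟨e, he0, heη⟩ : ∃ e : ℝ, 0 < e ∧ ENNReal.ofReal e ≤ η := by
    refine ⟨(min η 1).toReal, ENNReal.toReal_pos (lt_min hη one_pos).ne'
      (ne_top_of_le_ne_top ENNReal.one_ne_top (min_le_right _ _)), ?_⟩
    rw [ENNReal.ofReal_toReal (ne_top_of_le_ne_top ENNReal.one_ne_top (min_le_right _ _))]
    exact min_le_left _ _
  set M : ℝ := max 1 (D / e)
  have hM1 : 1 ≤ M := le_max_left _ _
  have hM4 : D / M ^ 4 ≤ e := by
    rw [div_le_iff₀ (by positivity), mul_comm]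
    calc D = D / e * e := by field_simp
      _ ≤ M ^ 4 * e := by
        gcongr
        exact (le_max_right _ _).trans (le_self_pow₀ hM1 (by norm_num))
  refine ⟨modulusSet S T ρ (2 * ((3 / (1 - ρ)) ^ 2 * M)),
    isCompact_modulusSet hS hT hρ0.le hρ1, ?_⟩
  rintro _ ⟨i, rfl⟩
  obtain ⟨hdm, hdi⟩ := hD P (X i) (hmeas i) (hmom i)
  rw [Measure.map_apply (hYm i) (isClosed_modulusSet S T _ _).measurableSet.compl]
  calc P (Y i ⁻¹' (modulusSet S T ρ (2 * ((3 / (1 - ρ)) ^ 2 * M)))ᶜ)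
      ≤ P {ω | ENNReal.ofReal (M ^ 4) ≤
          dyadicSum ρ fun u v => X i (S * u) (T * v) ω} := by
        refine measure_mono fun ω hω => ?_
        rw [Set.mem_preimage, Set.mem_compl_iff] at hω
        rw [Set.mem_ofPred_eq]
        by_contra hlt
        rw [not_le] at hlt
        have hM0 : 0 ≤ M := by linarith
        exact hω (mem_modulusSet_of_dyadicSum_le (f := fun u v => X i u v ω) hS hT hρ0 hρ1 hM0
          (hcont i ω) (fun t => hX1 i t ω) (fun s => hX2 i s ω) hlt.le (hY i ω))
    _ ≤ (∫⁻ ω, dyadicSum ρ (fun u v => X i (S * u) (T * v) ω) ∂P) /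
          ENNReal.ofReal (M ^ 4) :=
        meas_ge_le_lintegral_div hdm.aemeasurable (ENNReal.ofReal_pos.2 (by positivity)).ne'
          ENNReal.ofReal_ne_top
    _ ≤ ENNReal.ofReal D / ENNReal.ofReal (M ^ 4) := ENNReal.div_le_div_right hdi _
    _ = ENNReal.ofReal (D / M ^ 4) := (ENNReal.ofReal_div_of_pos (by positivity)).symm
    _ ≤ η := (ENNReal.ofReal_le_ofReal hM4).trans heη

/-! ### The rescaled fields -/

section ApproxField

variable {Ω : Type*} {L : ℝ≥0 → ℝ≥0 → Ω → ℝ} {Ψ : ℝ → ℂ} {θ : ℝ}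

lemma approxField_eq (ε s t : ℝ) (ω : Ω) : approxField L Ψ θ ε s t ω =
    (ε : ℂ) * (normConst Ψ θ : ℂ) * boxIntegral L θ 0 (s / ε) 0 (t / ε) ω := rfl

lemma approxField_zero_left (ε t : ℝ) (ω : Ω) : approxField L Ψ θ ε 0 t ω = 0 := by
  simp [approxField]

lemma approxField_zero_right (ε s : ℝ) (ω : Ω) : approxField L Ψ θ ε s 0 ω = 0 := by
  simp [approxField]

variable [MeasurableSpace Ω] {P : Measure Ω}

lemma increment_approxField (hL : Measurable fun p : (ℝ≥0 × ℝ≥0) × Ω => L p.1.1 p.1.2 p.2)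
    (ε s t s' t' : ℝ) (ω : Ω) :
    increment (fun u v => approxField L Ψ θ ε u v ω) s t s' t' =
      (ε : ℂ) * (normConst Ψ θ : ℂ) * boxIntegral L θ (s / ε) (s' / ε) (t / ε) (t' / ε) ω := by
  rw [← increment_boxIntegral hL]
  simp only [increment, approxField_eq]
  ring

lemma continuous_approxField (hL : Measurable fun p : (ℝ≥0 × ℝ≥0) × Ω => L p.1.1 p.1.2 p.2)
    (ε : ℝ) (ω : Ω) : Continuous fun p : ℝ × ℝ => approxField L Ψ θ ε p.1 p.2 ω := by
  simp only [approxField_eq]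
  exact continuous_const.mul ((continuous_boxIntegral hL ω).comp
    (by fun_prop : Continuous fun p : ℝ × ℝ => (p.1 / ε, p.2 / ε)))

lemma measurable_approxField (hL : Measurable fun p : (ℝ≥0 × ℝ≥0) × Ω => L p.1.1 p.1.2 p.2)
    {ε s t : ℝ} (hε : 0 < ε) (hs : 0 ≤ s) (ht : 0 ≤ t) : Measurable (approxField L Ψ θ ε s t) :=
  (measurable_boxIntegral hL (by positivity) (by positivity)).const_mul _

/-- The factor `ε⁴` cancels the scaling of the squared area. -/
theorem IsLevySheet.lintegral_increment_approxField_le [IsProbabilityMeasure P]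
    (hLs : IsLevySheet L Ψ P) (hL : Measurable fun p : (ℝ≥0 × ℝ≥0) × Ω => L p.1.1 p.1.2 p.2)
    (ha : 0 < (Ψ θ).re) {ε s t s' t' : ℝ} (hε : 0 < ε) (hs : 0 ≤ s) (hss : s ≤ s') (ht : 0 ≤ t)
    (htt : t ≤ t') :
    ∫⁻ ω, ‖increment (fun u v => approxField L Ψ θ ε u v ω) s t s' t'‖ₑ ^ 4 ∂P ≤
      ENNReal.ofReal ((16 * normConst Ψ θ * (√384 / (Ψ θ).re)) ^ 4 * (s' - s) ^ 2 *
        (t' - t) ^ 2) := by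
  set K := normConst Ψ θ
  set Z := boxIntegral L θ (s / ε) (s' / ε) (t / ε) (t' / ε) with hZ
  have h1 : s / ε ≤ s' / ε := by gcongr
  have h2 : t / ε ≤ t' / ε := by gcongr
  have hb := hLs.lpNorm_boxIntegral_le hL ha (div_nonneg hs hε.le) (div_nonneg ht hε.le) h1 h2
  have hb4 : ∫ ω, ‖Z ω‖ ^ 4 ∂P ≤
      (16 * (√384 / (Ψ θ).re)) ^ 4 * ((s' - s) / ε) ^ 2 * ((t' - t) / ε) ^ 2 := by
    rw [← lpNorm_four_pow (measurable_boxIntegral hL h1 h2).aestronglyMeasurable]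
    refine (pow_le_pow_left₀ lpNorm_nonneg hb 4).trans (le_of_eq ?_)
    have e : ∀ x : ℝ, 0 ≤ x → √x ^ 4 = x ^ 2 := fun x hx => by
      rw [show (4 : ℕ) = 2 * 2 from rfl, pow_mul, Real.sq_sqrt hx]
    rw [mul_pow, e _ (sub_nonneg.2 h1), mul_pow, mul_pow, mul_pow, e _ (sub_nonneg.2 h2), sub_div,
      sub_div, mul_pow]
    ring
  have hint : Integrable (fun ω => ‖Z ω‖ ^ 4) P := by
    have := (memLp_boxIntegral (P := P) (θ := θ) hL h1 h2 4).integrable_norm_pow (by norm_num)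
    simpa using this
  calc ∫⁻ ω, ‖increment (fun u v => approxField L Ψ θ ε u v ω) s t s' t'‖ₑ ^ 4 ∂P
      = ∫⁻ ω, ENNReal.ofReal ((ε * K) ^ 4 * ‖Z ω‖ ^ 4) ∂P := by
        refine lintegral_congr fun ω => ?_
        rw [increment_approxField hL, ← ofReal_norm, ← ENNReal.ofReal_pow (norm_nonneg _), norm_mul,
          norm_mul, Complex.norm_real, Complex.norm_real, mul_pow, mul_pow, mul_pow,
          Real.norm_eq_abs, Real.norm_eq_abs, Even.pow_abs (by decide), Even.pow_abs (by decide)]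
    _ = ENNReal.ofReal ((ε * K) ^ 4 * ∫ ω, ‖Z ω‖ ^ 4 ∂P) := by
        rw [← integral_const_mul, ofReal_integral_eq_lintegral_ofReal (hint.const_mul _)
          (.of_forall fun ω => mul_nonneg (Even.pow_nonneg (by decide) _) (by positivity))]
    _ ≤ _ := by
        refine ENNReal.ofReal_le_ofReal ((mul_le_mul_of_nonneg_left hb4
          (Even.pow_nonneg (by decide) _)).trans (le_of_eq ?_))
        field_simp

end ApproxField

end LevySheet

theorem proposition3p1 {Ω : Type*} [MeasurableSpace Ω] (P : Measure Ω) [IsProbabilityMeasure P]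
    (L : ℝ≥0 → ℝ≥0 → Ω → ℝ) (Ψ : ℝ → ℂ) (hL : LevySheet.IsLevySheet L Ψ P)
    (hLmeas : Measurable (fun p : (ℝ≥0 × ℝ≥0) × Ω => L p.1.1 p.1.2 p.2))
    (θ : ℝ) (hθ : θ ∈ Set.Ioo 0 (2 * Real.pi)) (ha : (Ψ θ).re ≠ 0)
    (S T : ℝ) (hS : 0 < S) (hT : 0 < T) :
    (∃ C : ℝ, 0 < C ∧ ∀ s t s' t' : ℝ, 0 ≤ s → s < s' → s' ≤ S → 0 ≤ t → t < t' → t' ≤ T →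
      (⨆ (ε : ℝ) (_ : 0 < ε),
        ∫⁻ ω, ‖LevySheet.increment
          (fun u v => LevySheet.approxField L Ψ θ ε u v ω) s t s' t'‖ₑ ^ 4 ∂P)
        ≤ ENNReal.ofReal (C * (s' - s) ^ 2 * (t' - t) ^ 2)) ∧
    (∃ Y : ℝ → Ω → LevySheet.PathSpace S T,
      (∀ ε, 0 < ε → ∀ ω p, Y ε ω p = LevySheet.approxField L Ψ θ ε p.1 p.2 ω) ∧
      (∀ ε, 0 < ε → Measurable (Y ε)) ∧
      IsTightMeasureSet {μ | ∃ ε, 0 < ε ∧ μ = P.map (Y ε)}) := by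
  have ha0 : 0 < (Ψ θ).re := (hL.re_exponent_nonneg θ).lt_of_ne' ha
  set C := (16 * LevySheet.normConst Ψ θ * (√384 / (Ψ θ).re)) ^ 4 with hC
  have hC0 : 0 < C := by
    refine Even.pow_pos (by decide) (mul_ne_zero (mul_ne_zero (by norm_num) ?_) (by positivity))
    have : 0 < LevySheet.normConst Ψ θ := by
      unfold LevySheet.normConst
      positivity
    exact this.ne'
  have hmom : ∀ ε : ℝ, 0 < ε → ∀ s t s' t' : ℝ, 0 ≤ s → s < s' → s' ≤ S → 0 ≤ t → t < t' → t' ≤ T →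
      ∫⁻ ω, ‖LevySheet.increment
          (fun u v => LevySheet.approxField L Ψ θ ε u v ω) s t s' t'‖ₑ ^ 4 ∂P ≤
        ENNReal.ofReal (C * (s' - s) ^ 2 * (t' - t) ^ 2) := fun ε hε s t s' t' hs hss _ ht htt _ =>
    hL.lintegral_increment_approxField_le hLmeas ha0 hε hs hss.le ht htt.le
  refine ⟨⟨C, hC0, fun s t s' t' h1 h2 h3 h4 h5 h6 =>
    iSup₂_le fun ε hε => hmom ε hε s t s' t' h1 h2 h3 h4 h5 h6⟩, ?_⟩
  let Y : ℝ → Ω → LevySheet.PathSpace S T := fun ε ω =>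
    ⟨fun p => LevySheet.approxField L Ψ θ ε p.1 p.2 ω,
      (LevySheet.continuous_approxField hLmeas ε ω).comp
        (f := fun p : Set.Icc (0 : ℝ) S × Set.Icc (0 : ℝ) T => ((p.1 : ℝ), (p.2 : ℝ)))
        (by fun_prop)⟩
  have hYm : ∀ ε, 0 < ε → Measurable (Y ε) := fun ε hε =>
    LevySheet.measurable_of_measurable_eval fun p =>
      LevySheet.measurable_approxField hLmeas hε p.1.2.1 p.2.2.1
  refine ⟨Y, fun _ _ _ _ => rfl, hYm, ?_⟩
  have h := LevySheet.isTightMeasureSet_of_increment_moment P hS hT hC0.le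
    (fun (ε : {ε : ℝ // 0 < ε}) s t ω => LevySheet.approxField L Ψ θ ε s t ω)
    (fun ε ω => LevySheet.continuous_approxField hLmeas ε ω)
    (fun ε s t hs ht => LevySheet.measurable_approxField hLmeas ε.2 hs ht)
    (fun ε t ω => LevySheet.approxField_zero_left ε t ω)
    (fun ε s ω => LevySheet.approxField_zero_right ε s ω)
    (fun ε => hmom ε ε.2) (fun ε => Y ε) (fun _ _ _ => rfl) (fun ε => hYm ε ε.2)
  refine h.subset ?_
  rintro _ ⟨ε, hε, rfl⟩
  exact ⟨⟨ε, hε⟩, rfl⟩
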